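/- **Setting.** There are $m\ge 1$ asynchronous processes with identifiers $1,\dots,m$ and $n\ge m$ jobs $1,\dots,n$; processes communicate through atomic read/write cells. Algorithm $KK_\beta$ (termination parameter $\beta\in\mathbb N$, $\beta\ge m$) uses shared cells $next_q$ ($1\le q\le m$) and $done_{q,i}$ ($1\le q\le m$, $1\le i\le n$), all initially $0$. Process $p$ keeps sets $FREE_p$ (initially $\{1,\dots,n\}$), $DONE_p$ and $TRY_p$ (initially empty), and pointers $pos_p(q)$, initially $1$. It repeats the following, every read, write and local computation being a separate atomic step. 1. (compNext) If $|FREE_p\setminus TRY_p|<\beta$, terminate. Otherwise let $t=(|FREE_p|-(m-1))/m$, let $x$ be the element of $FREE_p\setminus TRY_p$ whose rank in ascending order is $\lfloor (p-1)t\rfloor+1$ if $t\ge 1$ and $p$ if $t<1$, and reset $TRY_p=\emptyset$. 2. (setNext) Write $next_p:=x$. 3. (gatherTry) For $q=1,\dots,m$, $q\ne p$, read $next_q$ and add the value to $TRY_p$. 4. (gatherDone) For $q=1,\dots,m$, $q\neq p$: as long as $pos_p(q)\le n$ and the value read from $done_{q,pos_p(q)}$ is positive, add this value to $DONE_p$,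 remove it from $FREE_p$ and increase $pos_p(q)$ by one. 5. (check) If $x\in TRY_p\cup DONE_p$, go back to 1. Otherwise perform job $x$ (action $do_{p,x}$), then write $done_{p,pos_p(p)}:=x$, add $x$ to $DONE_p$, remove it from $FREE_p$, increase $pos_p(p)$ by one, and go back to 1. An adversary chooses the interleaving and may crash a process at any time by an action $stop_p$, after which $p$ takes no action. A finite execution is fair if no action other than a crash is enabled in its last state; an infinite one is fair if every action other than a crash is performed infinitely often or is disabled in infinitely many states. The effectiveness $E(n,m,f)$ is the minimum, over all fair executions with at most $f$ crashes, of the number of distinct jobs performed. **Theorem.** Let $\beta\ge m$, $n\ge m$ and $0\le f\le m-1$. (i) Every fair execution of $KK_\beta$ with at most $f$ crashes is finite, and at least $n-(\beta+m-2)$ jobs are performed in it. (ii) If moreover $n\ge \beta+m-1$ and $m(\beta-m+f)<(f+1)(n-m+1)$, then $$E(n,m,f)=n-(\beta+m-2).$$ (Given $n\ge\beta+m-1$, the second inequality holds automatically if $f=m-1$, or if $\beta=m$, or if $n\ge m(\beta-m+1)$.) (iii) In particular, if $\beta=m$ and $n\ge 2m-1$, then $E(n,m,f)=n-(2m-2)=n-2m+2$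 for every $f\le m-1$. -/

import Mathlib

namespace KK

/-! ### Automata, executions, fairness -/

/-- An input/output automaton: start states, transitions, and which actions are locally
controlled (output or internal; the remaining ones are inputs). -/
structure Automaton (σ α : Type) where
  start : Set σ
  trans : σ → α → σ → Prop
  isLocal : α → Prop

variable {σ α : Type}

/-- An action is enabled in a state if some transition with this action leaves the state. -/
def Automaton.Enabled (A : Automaton σ α) (s : σ) (a : α) : Prop :=
  ∃ s', A.trans s a s'

/-- An execution `s₀, π₁, s₁, π₂, s₂, …` with `len` actions, `len ∈ ℕ ∪ {∞}`. Here `state k` is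
`sₖ` and `act k` is `πₖ₊₁`; only the states `state k` with `k ≤ len` and the actions `act k` with
`k < len` belong to the execution. -/
structure Execution (A : Automaton σ α) where
  len : ℕ∞
  state : ℕ → σ
  act : ℕ → α
  start_mem : state 0 ∈ A.start
  step : ∀ k : ℕ, (k : ℕ∞) < len → A.trans (state k) (act k) (state (k + 1))

/-- The action `a` occurs in the execution. -/
def Execution.Occurs {A : Automaton σ α} (e : Execution A) (a : α) : Prop :=
  ∃ k : ℕ, (k : ℕ∞) < e.len ∧ e.act k = a

/-- A finite execution is fair if no locally controlled action is enabled in its last state; an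
infinite one is fair if every locally controlled action is performed infinitely many times or is
disabled in infinitely many states. -/
def Execution.Fair {A : Automaton σ α} (e : Execution A) : Prop :=
  (∀ r : ℕ, e.len = r → ∀ a, A.isLocal a → ¬ A.Enabled (e.state r) a) ∧
  (e.len = ⊤ → ∀ a, A.isLocal a →
    {k : ℕ | e.act k = a}.Infinite ∨ {k : ℕ | ¬ A.Enabled (e.state k) a}.Infinite)

/-! ### The algorithm

There are `m` processes and `n` jobs. Process number `p ∈ {1, …, m}` is the element `p - 1` of
`Fin m`; jobs are the numbers `1, …, n`, and `0` is the initial value of every shared cell. -/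

/-- The status of a process; `perform` and `record` are the statuses "do" and "done". -/
inductive Status
  | compNext | setNext | gatherTry | gatherDone | check | perform | record | finished | stopped
  deriving DecidableEq

/-- The internal variables of a process. (The temporary variable of the algorithm is always
assigned before it is used within the same action, so it is not part of the state.) -/
structure LocalState (m : ℕ) where
  status : Status
  free : Finset ℕ
  done : Finset ℕ
  try_ : Finset ℕ
  /-- `pos q` points into row `q` of the shared matrix; columns are numbered from 1. -/
  pos : Fin m → ℕ
  /-- The job that the process is attempting to perform. -/
  nxt : ℕ
  /-- Loop index over processes. -/
  q : Fin m

/-- A global state: the shared array `next`, the shared matrix `done` (columns `1, …, n` are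
used), and the local state of every process. -/
structure State (m : ℕ) where
  next : Fin m → ℕ
  done : Fin m → ℕ → ℕ
  loc : Fin m → LocalState m

/-- The actions. `crash` is the only input action; `perform p j` is the output action
"process `p` performs job `j`"; the other actions are internal. -/
inductive Action (m : ℕ)
  | crash (p : Fin m)
  | compNext (p : Fin m)
  | setNext (p : Fin m)
  | gatherTry (p : Fin m)
  | gatherDone (p : Fin m)
  | check (p : Fin m)
  | perform (p : Fin m) (j : ℕ)
  | record (p : Fin m)

/-- The element of rank `i` of `S` in ascending order, ranks being counted from 1. -/
def elementOfRank (S : Finset ℕ) (i : ℕ) : ℕ :=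
  (S.sort (· ≤ ·)).getD (i - 1) 0

/-- The rank computed by process number `p + 1` when its set of free jobs has `k` elements:
with `t = (k - (m - 1)) / m` it is `⌊p * t⌋ + 1` if `t ≥ 1`, and `p + 1` otherwise. -/
def chosenRank (m k p : ℕ) : ℕ :=
  let t : ℚ := ((k : ℚ) - ((m : ℚ) - 1)) / m
  if 1 ≤ t then ⌊(p : ℚ) * t⌋₊ + 1 else p + 1

/-- Advance the loop index; after the last process, reset it and move to status `st`. -/
def LocalState.advance {m : ℕ} (l : LocalState m) (st : Status) : LocalState m :=
  if h : l.q.val + 1 < m then { l with q := ⟨l.q.val + 1, h⟩ }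
  else { l with q := ⟨0, l.q.pos⟩, status := st }

/-- Effect of `compNext` on process `p`, with termination parameter `β`. -/
def LocalState.compNext {m : ℕ} (β : ℕ) (p : Fin m) (l : LocalState m) : LocalState m :=
  if β ≤ (l.free \ l.try_).card then
    { l with
      nxt := elementOfRank (l.free \ l.try_) (chosenRank m l.free.card p.val)
      q := ⟨0, p.pos⟩
      try_ := ∅
      status := .setNext }
  else { l with status := .finished }

/-- Effect of `gatherTry` on process `p`: read `next` at the loop index, then advance. -/
def LocalState.gatherTry {m : ℕ} (n : ℕ) (next : Fin m → ℕ) (p : Fin m) (l : LocalState m) :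
    LocalState m :=
  (if l.q ≠ p ∧ next l.q ≤ n then { l with try_ := insert (next l.q) l.try_ } else l).advance
    .gatherDone

/-- Effect of `gatherDone` on process `p`: read a fresh entry of the row given by the loop index;
if there is none, advance. -/
def LocalState.gatherDone {m : ℕ} (n : ℕ) (done : Fin m → ℕ → ℕ) (p : Fin m)
    (l : LocalState m) : LocalState m :=
  if l.q ≠ p ∧ l.pos l.q ≤ n ∧ 0 < done l.q (l.pos l.q) then
    { l with
      done := insert (done l.q (l.pos l.q)) l.done
      free := l.free.erase (done l.q (l.pos l.q))
      pos := Function.update l.pos l.q (l.pos l.q + 1) }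
  else l.advance .check

/-- Effect of `check`. -/
def LocalState.check {m : ℕ} (l : LocalState m) : LocalState m :=
  if l.nxt ∉ l.try_ ∧ l.nxt ∉ l.done then { l with status := .perform }
  else { l with status := .compNext }

/-- Effect of `record` on the local state of process `p`. -/
def LocalState.record {m : ℕ} (p : Fin m) (l : LocalState m) : LocalState m :=
  { l with
    done := insert l.nxt l.done
    free := l.free.erase l.nxt
    pos := Function.update l.pos p (l.pos p + 1)
    status := .compNext }

/-- Replace the local state of process `p`. -/
def State.setLoc {m : ℕ} (s : State m) (p : Fin m) (l : LocalState m) : State m :=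
  { s with loc := Function.update s.loc p l }

/-- The unique start state. -/
def initState (n m : ℕ) : State m where
  next := fun _ => 0
  done := fun _ _ => 0
  loc := fun p =>
    { status := .compNext
      free := Finset.Icc 1 n
      done := ∅
      try_ := ∅
      pos := fun _ => 1
      nxt := 0
      q := ⟨0, p.pos⟩ }

/-- The transitions. A crashed process takes no further action, in particular it does not crash
again; a process may crash at any other time. -/
def trans (n m β : ℕ) (s : State m) : Action m → State m → Prop
  | .crash p, s' => (s.loc p).status ≠ .stopped ∧
      s' = s.setLoc p { s.loc p with status := .stopped }
  | .compNext p, s' => (s.loc p).status = .compNext ∧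
      s' = s.setLoc p ((s.loc p).compNext β p)
  | .setNext p, s' => (s.loc p).status = .setNext ∧
      s' = { s.setLoc p { s.loc p with status := .gatherTry } with
        next := Function.update s.next p (s.loc p).nxt }
  | .gatherTry p, s' => (s.loc p).status = .gatherTry ∧
      s' = s.setLoc p ((s.loc p).gatherTry n s.next p)
  | .gatherDone p, s' => (s.loc p).status = .gatherDone ∧
      s' = s.setLoc p ((s.loc p).gatherDone n s.done p)
  | .check p, s' => (s.loc p).status = .check ∧
      s' = s.setLoc p (s.loc p).check
  | .perform p j, s' => (s.loc p).status = .perform ∧ (s.loc p).nxt = j ∧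
      s' = s.setLoc p { s.loc p with status := .record }
  | .record p, s' => (s.loc p).status = .record ∧
      s' = { s.setLoc p ((s.loc p).record p) with
        done := Function.update s.done p
          (Function.update (s.done p) ((s.loc p).pos p) (s.loc p).nxt) }

/-- The algorithm for `n` jobs and `m` processes with termination parameter `β`. -/
def algorithm (n m β : ℕ) : Automaton (State m) (Action m) where
  start := {initState n m}
  trans := trans n m β
  isLocal := fun a => ∀ p, a ≠ .crash p

/-! ### Effectiveness -/

variable {m : ℕ} {A : Automaton (State m) (Action m)}

/-- The set of processes that crash in the execution. -/
def crashed (e : Execution A) : Set (Fin m) :=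
  {p | e.Occurs (.crash p)}

/-- The number of jobs among `1, …, n` that are performed in the execution. -/
noncomputable def numDone (n : ℕ) (e : Execution A) : ℕ :=
  {j : ℕ | j ∈ Finset.Icc 1 n ∧ ∃ p, e.Occurs (.perform p j)}.ncard

/-- The fair executions with at most `f` crashes. -/
def fairExecs (A : Automaton (State m) (Action m)) (f : ℕ) : Set (Execution A) :=
  {e | e.Fair ∧ (crashed e).ncard ≤ f}

/-- `A` has effectiveness `v` for `n` jobs and `f` crashes: `v` is the minimum, over all fair
executions with at most `f` crashes, of the number of performed jobs. -/
def HasEffectiveness (A : Automaton (State m) (Action m)) (n f v : ℕ) : Prop :=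
  IsLeast (numDone n '' fairExecs A f) v

end KK

/-!
Suppose a run is infinite. Each process performs, records and learns of at most `n` jobs, so from
some time on none of this happens any more, and nobody crashes or terminates. From then on the sets
`FREE` of the processes that still move are constant, and they coincide, since every recorded job
is read by everybody. The rank selected in `compNext` is strictly increasing in the identifier, so
the moving process with the smallest identifier selects a job of smaller rank than all the others;
eventually it always selects the same job, meets no conflict in `check`, and performs this job after
all: a contradiction.

A process that has terminated has `|FREE \ TRY| < β` with `|TRY| ≤ m - 1`, which gives the lower
bound. For the upper bound, the adversary lets process `1` do all the work. Every other process
selects a job at the very beginning; some of them announce it and crash, so that their jobs are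
avoided for ever, and the rest announce theirs only when process `1` has announced the same job, so
that both give it up. When fewer than `β` jobs are left, all processes terminate, and the `m - 1`
selected jobs have been performed by nobody.
-/

namespace KK

open Filter Finset

variable {n m β : ℕ}

theorem elementOfRank_eq_nth (S : Finset ℕ) (i : ℕ) :
    elementOfRank S i = Nat.nth (· ∈ S) (i - 1) := by
  have hS : (Set.ofPred (· ∈ S)).Finite := S.finite_toSet
  rw [Nat.nth_eq_getD_sort hS, elementOfRank, show hS.toFinset = S by ext; simp]

theorem elementOfRank_mem {S : Finset ℕ} {i : ℕ} (hi : 1 ≤ i) (hS : i ≤ #S) :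
    elementOfRank S i ∈ S := by
  rw [elementOfRank_eq_nth]
  refine Nat.nth_mem (p := (· ∈ S)) _ fun hf => ?_
  rw [show hf.toFinset = S by ext; simp]
  omega

theorem count_elementOfRank {S : Finset ℕ} {i : ℕ} (hi : 1 ≤ i) (hS : i ≤ #S) :
    Nat.count (· ∈ S) (elementOfRank S i) + 1 = i := by
  rw [elementOfRank_eq_nth, Nat.count_nth fun hf => ?_]
  · omega
  · rw [show hf.toFinset = S by ext; simp]
    omega

theorem elementOfRank_count_add_one {S : Finset ℕ} {x : ℕ} (hx : x ∈ S) :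
    elementOfRank S (Nat.count (· ∈ S) x + 1) = x := by
  rw [elementOfRank_eq_nth]
  exact Nat.nth_count (p := (· ∈ S)) hx

theorem elementOfRank_sdiff_eq {G S T : Finset ℕ} {r : ℕ} (hST : S ⊆ T) (h1 : 1 ≤ r)
    (hr : r ≤ #(G \ S)) (hT : ∀ z ∈ T, z ∈ S ∨ r ≤ Nat.count (· ∈ G \ S) z) :
    elementOfRank (G \ T) r = elementOfRank (G \ S) r := by
  set x := elementOfRank (G \ S) r
  have hx : x ∈ G \ S := elementOfRank_mem h1 hr
  have hcount : Nat.count (· ∈ G \ S) x + 1 = r := count_elementOfRank h1 hr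
  have hmem : ∀ y ≤ x, y ∈ G \ T ↔ y ∈ G \ S := by
    intro y hy
    have hle : Nat.count (· ∈ G \ S) y ≤ Nat.count (· ∈ G \ S) x := Nat.count_monotone _ hy
    have hyT : y ∈ T → y ∈ S := fun h => (hT y h).resolve_right (by omega)
    simp only [Finset.mem_sdiff]
    exact and_congr_right fun _ => not_congr ⟨hyT, fun h => hST h⟩
  have hcount' : Nat.count (· ∈ G \ T) x = Nat.count (· ∈ G \ S) x :=
    le_antisymm (Nat.count_mono_left fun y hy => (hmem y hy.le).1)
      (Nat.count_mono_left fun y hy => (hmem y hy.le).2)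
  rw [← hcount, ← hcount']
  exact elementOfRank_count_add_one ((hmem x le_rfl).2 hx)

theorem one_le_chosenRank (m k p : ℕ) : 1 ≤ chosenRank m k p := by
  simp only [chosenRank]
  split <;> omega

theorem chosenRank_zero (m k : ℕ) : chosenRank m k 0 = 1 := by
  simp [chosenRank]

theorem chosenRank_strictMono (m k : ℕ) : StrictMono (chosenRank m k) := by
  refine strictMono_nat_of_lt_succ fun p => ?_
  simp only [chosenRank]
  split_ifs with h
  · set t : ℚ := ((k : ℚ) - ((m : ℚ) - 1)) / m
    have hstep : ⌊(p : ℚ) * t + 1⌋₊ ≤ ⌊((p + 1 : ℕ) : ℚ) * t⌋₊ := by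
      apply Nat.floor_le_floor
      push_cast
      linarith
    rw [Nat.floor_add_one (by positivity)] at hstep
    omega
  · omega

theorem chosenRank_le {m k p b : ℕ} (hp : p < m) (hb : m ≤ b) (hk : k ≤ b + (m - 1)) :
    chosenRank m k p ≤ b := by
  have hm : (0 : ℚ) < m := by exact_mod_cast (Nat.zero_le p).trans_lt hp
  simp only [chosenRank]
  split_ifs with h
  · set t : ℚ := ((k : ℚ) - ((m : ℚ) - 1)) / m with ht
    have htm : t * m = (k : ℚ) - ((m : ℚ) - 1) := by rw [ht]; field_simp
    have hk' : (k : ℚ) + 1 ≤ b + m := by exact_mod_cast (by omega : k + 1 ≤ b + m)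
    have hp' : (p : ℚ) + 1 ≤ m := by exact_mod_cast hp
    rw [← Nat.floor_add_one (by positivity)]
    exact Nat.floor_le_of_le (by nlinarith)
  · omega

/-! ### The gathering loops -/

/-- The position of a status in the round `setNext`, `gatherTry`, `gatherDone`, `check`; every
status outside the gathering part of a round counts as later than these. -/
def Status.phase : Status → ℕ
  | .setNext => 0
  | .gatherTry => 1
  | .gatherDone => 2
  | .check => 3
  | _ => 4

namespace LocalState

/-- The processes that the gathering loop with status `st` has already handled in the current
round. -/
def visited (l : LocalState m) (st : Status) : Finset (Fin m) :=
  {j | st.phase < l.status.phase ∨ l.status = st ∧ j < l.q}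

theorem visited_of_phase_lt {l : LocalState m} {st : Status} (h : st.phase < l.status.phase) :
    l.visited st = univ := by
  simp [visited, h]

theorem visited_of_phase_gt {l : LocalState m} {st : Status} (h : l.status.phase < st.phase) :
    l.visited st = ∅ := by
  have hne : l.status ≠ st := fun e => h.ne (congrArg Status.phase e)
  simp [visited, h.le.not_gt, hne]

theorem visited_of_status_eq {l : LocalState m} {st : Status} (h : l.status = st) :
    l.visited st = Iio l.q := by
  ext j
  simp [visited, h]

theorem advance_spec (l : LocalState m) (st : Status) :
    (l.q.val + 1 < m ∧ (l.advance st).status = l.status ∧ (l.advance st).q.val = l.q.val + 1) ∨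
    (l.q.val + 1 = m ∧ (l.advance st).status = st ∧ (l.advance st).q.val = 0) := by
  unfold advance
  split_ifs with h
  · exact Or.inl ⟨h, rfl, rfl⟩
  · exact Or.inr ⟨by omega, rfl, rfl⟩

theorem visited_advance {l : LocalState m} {st : Status} (h : l.status.phase < st.phase) :
    (l.advance st).visited l.status = Iic l.q := by
  ext j
  rcases l.advance_spec st with ⟨-, hst, hq⟩ | ⟨hq, hst, -⟩
  · rw [visited_of_status_eq hst, mem_Iio, mem_Iic, Fin.lt_def, Fin.le_def]
    omega
  · rw [visited_of_phase_lt (hst.symm ▸ h), mem_Iic, Fin.le_def]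
    simp only [mem_univ, true_iff]
    omega

variable (l : LocalState m) (st : Status)

@[simp] theorem advance_free : (l.advance st).free = l.free := by
  unfold advance; split_ifs <;> rfl

@[simp] theorem advance_done : (l.advance st).done = l.done := by
  unfold advance; split_ifs <;> rfl

@[simp] theorem advance_try : (l.advance st).try_ = l.try_ := by
  unfold advance; split_ifs <;> rfl

@[simp] theorem advance_pos : (l.advance st).pos = l.pos := by
  unfold advance; split_ifs <;> rfl

@[simp] theorem advance_nxt : (l.advance st).nxt = l.nxt := by
  unfold advance; split_ifs <;> rfl

theorem advance_status_eq_or : (l.advance st).status = l.status ∨ (l.advance st).status = st :=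
  (l.advance_spec st).imp (·.2.1) (·.2.1)

theorem gatherTry_eq (next : Fin m → ℕ) (p : Fin m) :
    l.gatherTry n next p = { l.advance .gatherDone with
      try_ := if l.q ≠ p ∧ next l.q ≤ n then insert (next l.q) l.try_ else l.try_ } := by
  unfold gatherTry advance
  split_ifs <;> rfl

theorem mem_gatherTry_try {next : Fin m → ℕ} (hn : ∀ q, next q ≤ n) (p : Fin m) (z : ℕ) :
    z ∈ (l.gatherTry n next p).try_ ↔ z ∈ l.try_ ∨ l.q ≠ p ∧ z = next l.q := by
  have := hn l.q
  rw [gatherTry_eq]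
  split_ifs with h
  · rw [mem_insert]
    tauto
  · tauto

end LocalState

/-! ### Invariants -/

/-- The invariants of the local state of process `p`. -/
structure LocalInv (n β : ℕ) (p : Fin m) (l : LocalState m) : Prop where
  free_eq : l.free = Icc 1 n \ l.done
  pos_add_card_le : l.pos p + #l.free ≤ n + 1
  nxt_mem : l.status ∉ ({.compNext, .finished, .stopped} : Set Status) → l.nxt ∈ Icc 1 n
  nxt_mem_free : l.status ∈ ({.perform, .record} : Set Status) → l.nxt ∈ l.free
  card_try_le : #l.try_ ≤ #((l.visited .gatherTry).erase p)
  q_eq_zero : l.status = .setNext → l.q.val = 0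
  card_lt_of_finished : l.status = .finished → #(l.free \ l.try_) < β

namespace LocalInv

variable {p : Fin m} {l : LocalState m}

theorem card_try_le_pred (hl : LocalInv n β p l) : #l.try_ ≤ m - 1 :=
  calc #l.try_ ≤ #((l.visited .gatherTry).erase p) := hl.card_try_le
    _ ≤ #((univ : Finset (Fin m)).erase p) := card_le_card (erase_subset_erase p (subset_univ _))
    _ = m - 1 := by rw [card_erase_of_mem (mem_univ p), card_univ, Fintype.card_fin]

theorem chosenRank_le_card (hl : LocalInv n β p l) (hβ : m ≤ β) (h : β ≤ #(l.free \ l.try_)) :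
    chosenRank m #l.free p ≤ #(l.free \ l.try_) := by
  refine chosenRank_le p.2 (hβ.trans h) ?_
  have := le_card_sdiff l.try_ l.free
  have := hl.card_try_le_pred
  omega

/-- Once the first gathering loop is over, the bound on `TRY` no longer depends on the status. -/
theorem card_try_le_of_phase_lt (hl : LocalInv n β p l) {l' : LocalState m}
    (htry : l'.try_ = l.try_) (h : Status.gatherTry.phase < l'.status.phase) :
    #l'.try_ ≤ #((l'.visited .gatherTry).erase p) := by
  rw [LocalState.visited_of_phase_lt h, card_erase_of_mem (mem_univ p), card_univ,
    Fintype.card_fin, htry]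
  exact hl.card_try_le_pred

theorem compNext (hl : LocalInv n β p l) (hβ : m ≤ β) : LocalInv n β p (l.compNext β p) := by
  unfold LocalState.compNext
  split_ifs with h
  · have hmem := elementOfRank_mem (one_le_chosenRank _ _ _) (hl.chosenRank_le_card hβ h)
    have hsub : l.free \ l.try_ ⊆ Icc 1 n := by
      rw [hl.free_eq]
      exact sdiff_subset.trans sdiff_subset
    exact ⟨hl.free_eq, hl.pos_add_card_le, fun _ => hsub hmem, by simp, by simp, by simp, by simp⟩
  · exact ⟨hl.free_eq, hl.pos_add_card_le, by simp, by simp,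
      hl.card_try_le_of_phase_lt rfl (by simp [Status.phase]), by simp,
      fun _ => not_le.1 h⟩

theorem setNext (hl : LocalInv n β p l) (h : l.status = .setNext) :
    LocalInv n β p { l with status := .gatherTry } := by
  have htry : #l.try_ ≤ 0 := by
    simpa [LocalState.visited_of_phase_gt (l := l) (st := .gatherTry) (by simp [h, Status.phase])]
      using hl.card_try_le
  exact ⟨hl.free_eq, hl.pos_add_card_le, fun _ => hl.nxt_mem (by simp [h]), by simp,
    htry.trans (Nat.zero_le _), by simp, by simp⟩

theorem gatherTry (hl : LocalInv n β p l) (h : l.status = .gatherTry) (next : Fin m → ℕ) :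
    LocalInv n β p (l.gatherTry n next p) := by
  have hvisited : (l.advance .gatherDone).visited .gatherTry = Iic l.q := by
    rw [← LocalState.visited_advance (st := .gatherDone) (by simp [h, Status.phase]), h]
  have hcard : #(if l.q ≠ p ∧ next l.q ≤ n then insert (next l.q) l.try_ else l.try_) ≤
      #((Iic l.q).erase p) := by
    have hold : #l.try_ ≤ #((Iio l.q).erase p) := by
      simpa only [LocalState.visited_of_status_eq h] using hl.card_try_le
    rw [← Iio_insert]
    split_ifs with hq
    · have hnot : l.q ∉ (Iio l.q).erase p := by simp
      rw [erase_insert_of_ne hq.1, card_insert_of_notMem hnot]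
      exact (card_insert_le _ _).trans (Nat.succ_le_succ hold)
    · exact hold.trans (card_le_card (erase_subset_erase p (subset_insert _ _)))
  rw [LocalState.gatherTry_eq]
  rcases l.advance_status_eq_or .gatherDone with hst | hst <;>
  exact ⟨by simpa using hl.free_eq, by simpa using hl.pos_add_card_le,
    fun _ => by simpa using hl.nxt_mem (by simp [h]), by simp [hst, h],
    hcard.trans_eq (by rw [← hvisited]; rfl), by simp [hst, h], by simp [hst, h]⟩

theorem gatherDone (hl : LocalInv n β p l) (h : l.status = .gatherDone) (done : Fin m → ℕ → ℕ) :
    LocalInv n β p (l.gatherDone n done p) := by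
  have htry (l' : LocalState m) (ht : l'.try_ = l.try_)
      (hst : l'.status = .gatherDone ∨ l'.status = .check) :
      #l'.try_ ≤ #((l'.visited .gatherTry).erase p) :=
    hl.card_try_le_of_phase_lt ht (by rcases hst with hst | hst <;> simp [hst, Status.phase])
  have hnxt := hl.nxt_mem (by simp [h])
  unfold LocalState.gatherDone
  split_ifs with hread
  · refine ⟨?_, ?_, fun _ => hnxt, by simp [h], htry _ rfl (Or.inl h), by simp [h], by simp [h]⟩
    · change l.free.erase _ = Icc 1 n \ insert _ l.done
      rw [hl.free_eq, sdiff_insert]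
    · have := hl.pos_add_card_le
      have := card_erase_le (s := l.free) (a := done l.q (l.pos l.q))
      simp only [Function.update_of_ne hread.1.symm]
      omega
  · have hst := h ▸ l.advance_status_eq_or .check
    exact ⟨by simpa using hl.free_eq, by simpa using hl.pos_add_card_le,
      fun _ => by simpa using hnxt, by rcases hst with hst | hst <;> simp [hst],
      htry _ (by simp) hst, by rcases hst with hst | hst <;> simp [hst],
      by rcases hst with hst | hst <;> simp [hst]⟩

theorem check (hl : LocalInv n β p l) (h : l.status = .check) : LocalInv n β p l.check := by
  have hnxt := hl.nxt_mem (by simp [h])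
  unfold LocalState.check
  split_ifs with hconflict
  · exact ⟨hl.free_eq, hl.pos_add_card_le, fun _ => hnxt,
      fun _ => by simpa [hl.free_eq, hconflict.2] using hnxt,
      hl.card_try_le_of_phase_lt rfl (by simp [Status.phase]), by simp, by simp⟩
  · exact ⟨hl.free_eq, hl.pos_add_card_le, by simp, by simp,
      hl.card_try_le_of_phase_lt rfl (by simp [Status.phase]), by simp, by simp⟩

theorem perform (hl : LocalInv n β p l) (h : l.status = .perform) :
    LocalInv n β p { l with status := .record } :=
  ⟨hl.free_eq, hl.pos_add_card_le, fun _ => hl.nxt_mem (by simp [h]),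
    fun _ => hl.nxt_mem_free (by simp [h]),
    hl.card_try_le_of_phase_lt rfl (by simp [Status.phase]), by simp, by simp⟩

theorem record (hl : LocalInv n β p l) (h : l.status = .record) :
    LocalInv n β p (l.record p) := by
  refine ⟨?_, ?_, by simp [LocalState.record], by simp [LocalState.record],
    hl.card_try_le_of_phase_lt rfl (by simp [LocalState.record, Status.phase]),
    by simp [LocalState.record], by simp [LocalState.record]⟩
  · rw [LocalState.record, hl.free_eq, sdiff_insert]
  · have := hl.pos_add_card_le
    have := card_erase_add_one (hl.nxt_mem_free (by simp [h]))
    simp only [LocalState.record, Function.update_self]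
    omega

theorem crash (hl : LocalInv n β p l) : LocalInv n β p { l with status := .stopped } :=
  ⟨hl.free_eq, hl.pos_add_card_le, by simp, by simp,
    hl.card_try_le_of_phase_lt rfl (by simp [Status.phase]), by simp, by simp⟩

end LocalInv

/-- The invariants of a family of append-only logs with readers, abstracted from the matrix
`done`: row `q` of `mat` holds the log of `q` in the cells `1, …, pos q q - 1` (the others are
`0`), the reader `p` has read the cells `i < pos p q` of every row `q`, and `known p` is the set
of the values it has read. -/
structure LogInv {ι : Type*} (mat : ι → ℕ → ℕ) (pos : ι → ι → ℕ) (known : ι → Finset ℕ) :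
    Prop where
  cell_pos_iff : ∀ q i, 0 < mat q i ↔ 1 ≤ i ∧ i < pos q q
  one_le_pos : ∀ p q, 1 ≤ pos p q
  pos_le_diag : ∀ p q, pos p q ≤ pos q q
  mem_known : ∀ p z, z ∈ known p ↔ ∃ q i, 1 ≤ i ∧ i < pos p q ∧ mat q i = z

section LogInv

variable {ι : Type*} [DecidableEq ι] {mat : ι → ℕ → ℕ} {pos : ι → ι → ℕ} {known : ι → Finset ℕ}

theorem exists_lt_update_add_one {f : ι → ℕ} {j : ι} (hj : 1 ≤ f j) (P : ι → ℕ → Prop) :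
    (∃ q i, 1 ≤ i ∧ i < Function.update f j (f j + 1) q ∧ P q i) ↔
      P j (f j) ∨ ∃ q i, 1 ≤ i ∧ i < f q ∧ P q i := by
  simp only [Function.update_apply]
  constructor
  · rintro ⟨q, i, h1, h2, hP⟩
    split_ifs at h2 with hq
    · subst hq
      rcases Nat.lt_succ_iff_lt_or_eq.1 h2 with h2 | rfl
      · exact Or.inr ⟨q, i, h1, h2, hP⟩
      · exact Or.inl hP
    · exact Or.inr ⟨q, i, h1, h2, hP⟩
  · rintro (hP | ⟨q, i, h1, h2, hP⟩)
    · exact ⟨j, f j, hj, by simp, hP⟩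
    · refine ⟨q, i, h1, ?_, hP⟩
      split_ifs with hq
      · subst hq; omega
      · exact h2

theorem LogInv.read (h : LogInv mat pos known) {p j : ι} (hjp : j ≠ p)
    (hcell : 0 < mat j (pos p j)) :
    LogInv mat (Function.update pos p (Function.update (pos p) j (pos p j + 1)))
      (Function.update known p (insert (mat j (pos p j)) (known p))) := by
  have hlt : pos p j < pos j j := ((h.cell_pos_iff _ _).1 hcell).2
  have hdiag : ∀ q, Function.update pos p (Function.update (pos p) j (pos p j + 1)) q q =
      pos q q := by
    intro q
    rcases eq_or_ne q p with rfl | hq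
    · simp [hjp.symm]
    · simp [hq]
  refine ⟨fun q i => ?_, fun r q => ?_, fun r q => ?_, fun r z => ?_⟩
  · rw [hdiag, h.cell_pos_iff]
  · have := h.one_le_pos r q
    simp only [Function.update_apply]
    split_ifs <;> grind
  · have := h.pos_le_diag r q
    rw [hdiag]
    simp only [Function.update_apply]
    split_ifs <;> grind
  · rcases eq_or_ne r p with rfl | hr
    · simp only [Function.update_self, mem_insert, h.mem_known,
        exists_lt_update_add_one (h.one_le_pos r j), eq_comm]
    · simpa [hr] using h.mem_known r z

theorem LogInv.append (h : LogInv mat pos known) (p : ι) {x : ℕ} (hx : 0 < x) :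
    LogInv (Function.update mat p (Function.update (mat p) (pos p p) x))
      (Function.update pos p (Function.update (pos p) p (pos p p + 1)))
      (Function.update known p (insert x (known p))) := by
  have hold : ∀ r q i, i < pos r q →
      Function.update mat p (Function.update (mat p) (pos p p) x) q i = mat q i := by
    intro r q i hi
    rcases eq_or_ne q p with rfl | hq
    · simp [(hi.trans_le (h.pos_le_diag r q)).ne]
    · simp [hq]
  have hold_iff : ∀ r z, (∃ q i, 1 ≤ i ∧ i < pos r q ∧
      Function.update mat p (Function.update (mat p) (pos p p) x) q i = z) ↔ z ∈ known r := by
    intro r z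
    rw [h.mem_known]
    exact exists₂_congr fun q i => and_congr_right fun _ => and_congr_right fun hi => by
      rw [hold r q i hi]
  refine ⟨fun q i => ?_, fun r q => ?_, fun r q => ?_, fun r z => ?_⟩
  · have := h.cell_pos_iff q i
    have := h.one_le_pos q q
    rcases eq_or_ne q p with rfl | hq
    · simp only [Function.update_self, Function.update_apply]
      split_ifs <;> omega
    · simpa [hq] using h.cell_pos_iff q i
  · have := h.one_le_pos r q
    simp only [Function.update_apply]
    split_ifs <;> grind
  · have := h.pos_le_diag r q
    simp only [Function.update_apply]
    split_ifs <;> grind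
  · rcases eq_or_ne r p with rfl | hr
    · rw [Function.update_self, Function.update_self,
        exists_lt_update_add_one (h.one_le_pos r r), hold_iff]
      simp [eq_comm]
    · simpa only [Function.update_of_ne hr] using (hold_iff r z).symm

end LogInv

/-- The invariants of the reachable states. -/
structure Inv (n β : ℕ) (s : State m) : Prop where
  loc : ∀ p, LocalInv n β p (s.loc p)
  next_le : ∀ p, s.next p ≤ n
  log : LogInv s.done (fun p => (s.loc p).pos) (fun p => (s.loc p).done)

theorem inv_initState (n m β : ℕ) : Inv n β (initState n m) where
  loc p := by constructor <;> simp [initState, add_comm]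
  next_le := by simp [initState]
  log := by constructor <;> simp [initState]; omega

@[simp] theorem State.setLoc_loc_self (s : State m) (p : Fin m) (l : LocalState m) :
    (s.setLoc p l).loc p = l :=
  Function.update_self _ _ _

@[simp] theorem State.setLoc_loc_of_ne (s : State m) {p q : Fin m} (h : q ≠ p)
    (l : LocalState m) : (s.setLoc p l).loc q = s.loc q :=
  Function.update_of_ne h _ _

theorem State.comp_setLoc_loc {γ : Type*} (f : LocalState m → γ) (s : State m) (p : Fin m)
    (l : LocalState m) :
    (fun q => f ((s.setLoc p l).loc q)) = Function.update (fun q => f (s.loc q)) p (f l) :=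
  Function.comp_update f s.loc p l

namespace Inv

variable {s : State m}

theorem loc_setLoc (hs : Inv n β s) {p : Fin m} {l : LocalState m} (hl : LocalInv n β p l)
    (q : Fin m) : LocalInv n β q ((s.setLoc p l).loc q) := by
  rcases eq_or_ne q p with rfl | hq
  · simpa using hl
  · simpa [hq] using hs.loc q

theorem setLoc (hs : Inv n β s) {p : Fin m} {l : LocalState m} (hl : LocalInv n β p l)
    (hpos : l.pos = (s.loc p).pos) (hdone : l.done = (s.loc p).done) :
    Inv n β (s.setLoc p l) where
  loc := hs.loc_setLoc hl
  next_le := hs.next_le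
  log := by
    rw [State.comp_setLoc_loc LocalState.pos, State.comp_setLoc_loc LocalState.done, hpos, hdone,
      Function.update_eq_self, Function.update_eq_self]
    exact hs.log

theorem setNext (hs : Inv n β s) {p : Fin m} (h : (s.loc p).status = .setNext) :
    Inv n β { s.setLoc p { s.loc p with status := .gatherTry } with
      next := Function.update s.next p (s.loc p).nxt } := by
  have hquiet := hs.setLoc ((hs.loc p).setNext h) rfl rfl
  refine ⟨hquiet.loc, fun q => ?_, hquiet.log⟩
  rcases eq_or_ne q p with rfl | hq
  · simpa using (mem_Icc.1 ((hs.loc q).nxt_mem (by simp [h]))).2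
  · simpa [hq] using hs.next_le q

theorem gatherDone (hs : Inv n β s) {p : Fin m} (h : (s.loc p).status = .gatherDone) :
    Inv n β (s.setLoc p ((s.loc p).gatherDone n s.done p)) := by
  have hl := (hs.loc p).gatherDone h s.done
  by_cases hread : (s.loc p).q ≠ p ∧ (s.loc p).pos (s.loc p).q ≤ n ∧
      0 < s.done (s.loc p).q ((s.loc p).pos (s.loc p).q)
  · refine ⟨hs.loc_setLoc hl, hs.next_le, ?_⟩
    rw [State.comp_setLoc_loc LocalState.pos, State.comp_setLoc_loc LocalState.done,
      LocalState.gatherDone, if_pos hread]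
    exact hs.log.read hread.1 hread.2.2
  · exact hs.setLoc hl (by simp [LocalState.gatherDone, hread])
      (by simp [LocalState.gatherDone, hread])

theorem record (hs : Inv n β s) {p : Fin m} (h : (s.loc p).status = .record) :
    Inv n β { s.setLoc p ((s.loc p).record p) with
      done := Function.update s.done p
        (Function.update (s.done p) ((s.loc p).pos p) (s.loc p).nxt) } := by
  refine ⟨hs.loc_setLoc ((hs.loc p).record h), hs.next_le, ?_⟩
  have hnxt : 0 < (s.loc p).nxt := (mem_Icc.1 ((hs.loc p).nxt_mem (by simp [h]))).1
  change LogInv _ (fun q => ((s.setLoc p _).loc q).pos) fun q => ((s.setLoc p _).loc q).done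
  rw [State.comp_setLoc_loc LocalState.pos, State.comp_setLoc_loc LocalState.done]
  exact hs.log.append p hnxt

theorem pos_eq_of_not_read (hs : Inv n β s) {p j : Fin m} (hjp : j ≠ p)
    (hread : ¬ (j ≠ p ∧ (s.loc p).pos j ≤ n ∧ 0 < s.done j ((s.loc p).pos j))) :
    (s.loc p).pos j = (s.loc j).pos j := by
  have hcell := hs.log.cell_pos_iff j ((s.loc p).pos j)
  have hone := hs.log.one_le_pos p j
  have hle := hs.log.pos_le_diag p j
  have hmax := (hs.loc j).pos_add_card_le
  by_contra hne
  exact hread ⟨hjp, by omega, hcell.2 ⟨hone, by omega⟩⟩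

theorem step (hβ : m ≤ β) (hs : Inv n β s) {s' : State m} {a : Action m}
    (h : trans n m β s a s') : Inv n β s' := by
  cases a with
  | crash p =>
    obtain ⟨-, rfl⟩ := h
    exact hs.setLoc (hs.loc p).crash rfl rfl
  | compNext p =>
    obtain ⟨-, rfl⟩ := h
    apply hs.setLoc ((hs.loc p).compNext hβ) <;>
    · unfold LocalState.compNext
      split_ifs <;> rfl
  | setNext p =>
    obtain ⟨hst, rfl⟩ := h
    exact hs.setNext hst
  | gatherTry p =>
    obtain ⟨hst, rfl⟩ := h
    exact hs.setLoc ((hs.loc p).gatherTry hst _) (by simp [LocalState.gatherTry_eq])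
      (by simp [LocalState.gatherTry_eq])
  | gatherDone p =>
    obtain ⟨hst, rfl⟩ := h
    exact hs.gatherDone hst
  | check p =>
    obtain ⟨hst, rfl⟩ := h
    apply hs.setLoc ((hs.loc p).check hst) <;>
    · unfold LocalState.check
      split_ifs <;> rfl
  | perform p j =>
    obtain ⟨hst, -, rfl⟩ := h
    exact hs.setLoc ((hs.loc p).perform hst) rfl rfl
  | record p =>
    obtain ⟨hst, rfl⟩ := h
    exact hs.record hst

end Inv

theorem Execution.inv (hβ : m ≤ β) (e : Execution (algorithm n m β)) (k : ℕ)
    (hk : (k : ℕ∞) ≤ e.len) : Inv n β (e.state k) := by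
  induction k with
  | zero =>
    rw [show e.state 0 = initState n m from e.start_mem]
    exact inv_initState n m β
  | succ k ih =>
    have hlt : (k : ℕ∞) < e.len := lt_of_lt_of_le (by exact_mod_cast Nat.lt_succ_self k) hk
    exact (ih hlt.le).step hβ (e.step k hlt)

/-! ### Runs without progress -/

/-- A step of process `p` from the state `s` in which it neither performs a job, nor learns of one
from the matrix `done`, nor terminates; `QuietStep n β p s l x` means that the step leads to the
local state `l` and leaves the value `x` in `next p`. -/
inductive QuietStep (n β : ℕ) (p : Fin m) (s : State m) : LocalState m → ℕ → Prop
  | compNext (hst : (s.loc p).status = .compNext) (hβ : β ≤ #((s.loc p).free \ (s.loc p).try_)) :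
      QuietStep n β p s ((s.loc p).compNext β p) (s.next p)
  | setNext (hst : (s.loc p).status = .setNext) :
      QuietStep n β p s { s.loc p with status := .gatherTry } (s.loc p).nxt
  | gatherTry (hst : (s.loc p).status = .gatherTry) :
      QuietStep n β p s ((s.loc p).gatherTry n s.next p) (s.next p)
  | gatherDone (hst : (s.loc p).status = .gatherDone)
      (hread : ¬ ((s.loc p).q ≠ p ∧ (s.loc p).pos (s.loc p).q ≤ n ∧
        0 < s.done (s.loc p).q ((s.loc p).pos (s.loc p).q))) :
      QuietStep n β p s ((s.loc p).advance .check) (s.next p)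
  | check (hst : (s.loc p).status = .check)
      (hconflict : (s.loc p).nxt ∈ (s.loc p).try_ ∨ (s.loc p).nxt ∈ (s.loc p).done) :
      QuietStep n β p s { s.loc p with status := .compNext } (s.next p)

namespace LocalState

theorem compNext_of_le {l : LocalState m} {p : Fin m} (h : β ≤ #(l.free \ l.try_)) :
    l.compNext β p = { l with
      nxt := elementOfRank (l.free \ l.try_) (chosenRank m #l.free p)
      q := ⟨0, p.pos⟩
      try_ := ∅
      status := .setNext } :=
  if_pos h

theorem visited_advance_self {l : LocalState m} {st : Status} (h : l.status.phase < st.phase) :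
    (l.advance st).visited st = ∅ := by
  rcases l.advance_spec st with ⟨-, hst, -⟩ | ⟨-, hst, hq⟩
  · exact visited_of_phase_gt (hst ▸ h)
  · rw [visited_of_status_eq hst]
    ext j
    simp [Fin.lt_def, hq]

/-- The number of steps until the next `compNext`, as long as nothing is read from `done`. -/
def stepsLeft (l : LocalState m) : ℕ :=
  match l.status with
  | .check => 1
  | .gatherDone => m + 1 - l.q.val
  | .gatherTry => 2 * m + 2 - l.q.val
  | .setNext => 2 * m + 3
  | _ => 0

end LocalState

namespace QuietStep

variable {p : Fin m} {s : State m} {l : LocalState m} {x : ℕ}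

theorem free_eq (h : QuietStep n β p s l x) : l.free = (s.loc p).free := by
  cases h with
  | compNext _ hβ => rw [LocalState.compNext_of_le hβ]
  | gatherTry => simp [LocalState.gatherTry_eq]
  | gatherDone => simp
  | _ => rfl

theorem pos_eq (h : QuietStep n β p s l x) : l.pos = (s.loc p).pos := by
  cases h with
  | compNext _ hβ => rw [LocalState.compNext_of_le hβ]
  | gatherTry => simp [LocalState.gatherTry_eq]
  | gatherDone => simp
  | _ => rfl

theorem stepsLeft_lt (h : QuietStep n β p s l x) (hs : (s.loc p).status ≠ .compNext) :
    l.stepsLeft < (s.loc p).stepsLeft := by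
  have hq := (s.loc p).q.2
  cases h with
  | compNext hst => exact absurd hst hs
  | setNext hst =>
    simp only [LocalState.stepsLeft, hst]
    omega
  | gatherTry hst =>
    rw [LocalState.gatherTry_eq]
    rcases (s.loc p).advance_spec .gatherDone with ⟨_, hst', hq'⟩ | ⟨_, hst', hq'⟩ <;>
    · simp only [LocalState.stepsLeft, hst', hq', hst]
      omega
  | gatherDone hst =>
    rcases (s.loc p).advance_spec .check with ⟨_, hst', hq'⟩ | ⟨_, hst', -⟩
    · simp only [LocalState.stepsLeft, hst', hq', hst]
      omega
    · simp only [LocalState.stepsLeft, hst', hst]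
      omega
  | check hst => simp [LocalState.stepsLeft, hst]

end QuietStep

theorem exists_ge_eq_of_frequently {ι γ : Type*} {who : ℕ → ι} {f : ℕ → γ} {p : ι}
    (hp : ∃ᶠ k in atTop, who k = p) (hf : ∀ k, who k ≠ p → f (k + 1) = f k) (k : ℕ) :
    ∃ k' ≥ k, who k' = p ∧ f k' = f k := by
  obtain ⟨j, hj, hw⟩ := frequently_atTop.1 hp k
  induction j using Nat.strong_induction_on with
  | _ j ih =>
    by_cases hfirst : ∃ i, k ≤ i ∧ i < j ∧ who i = p
    · obtain ⟨i, hki, hij, hi⟩ := hfirst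
      exact ih i hij hki hi
    · refine ⟨j, hj, hw, ?_⟩
      push Not at hfirst
      exact Nat.le_induction (P := fun i _ => i ≤ j → f i = f k) (fun _ => rfl)
        (fun i hi hfi hle => (hf i (hfirst i hi hle)).trans (hfi (by omega))) j hj le_rfl

/-- An infinite run, started anywhere, in which only the processes in `L` take steps, each of
them infinitely many, and all steps are quiet. -/
structure QuietRun (n β : ℕ) (L : Finset (Fin m)) (st : ℕ → State m) (who : ℕ → Fin m) :
    Prop where
  inv : ∀ k, Inv n β (st k)
  who_mem : ∀ k, who k ∈ L
  frequently : ∀ p ∈ L, ∃ᶠ k in atTop, who k = p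
  step : ∀ k, QuietStep n β (who k) (st k) ((st (k + 1)).loc (who k)) ((st (k + 1)).next (who k))
  loc_of_ne : ∀ k q, who k ≠ q → (st (k + 1)).loc q = (st k).loc q
  next_of_ne : ∀ k q, who k ≠ q → (st (k + 1)).next q = (st k).next q

namespace QuietRun

variable {L : Finset (Fin m)} {st : ℕ → State m} {who : ℕ → Fin m} {p q j : Fin m}

theorem free_eq (h : QuietRun n β L st who) (k : ℕ) (p : Fin m) :
    ((st k).loc p).free = ((st 0).loc p).free := by
  induction k with
  | zero => rfl
  | succ k ih =>
    rcases eq_or_ne (who k) p with rfl | hp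
    · rw [(h.step k).free_eq, ih]
    · rw [h.loc_of_ne k p hp, ih]

theorem pos_eq (h : QuietRun n β L st who) (k : ℕ) (p : Fin m) :
    ((st k).loc p).pos = ((st 0).loc p).pos := by
  induction k with
  | zero => rfl
  | succ k ih =>
    rcases eq_or_ne (who k) p with rfl | hp
    · rw [(h.step k).pos_eq, ih]
    · rw [h.loc_of_ne k p hp, ih]

theorem next_eq (h : QuietRun n β L st who) (k : ℕ) (hp : p ∉ L) :
    (st k).next p = (st 0).next p := by
  induction k with
  | zero => rfl
  | succ k ih => rw [h.next_of_ne k p fun e => hp (e ▸ h.who_mem k), ih]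

theorem exists_compNext (h : QuietRun n β L st who) (hp : p ∈ L) (k : ℕ) :
    ∃ k' ≥ k, who k' = p ∧ ((st k').loc p).status = .compNext := by
  induction hd : ((st k).loc p).stepsLeft using Nat.strong_induction_on generalizing k with
  | _ d ih =>
    obtain ⟨k₁, hk₁, rfl, hloc⟩ := exists_ge_eq_of_frequently (h.frequently p hp)
      (f := fun k => (st k).loc p) (fun k => h.loc_of_ne k p) k
    by_cases hst : ((st k₁).loc (who k₁)).status = .compNext
    · exact ⟨k₁, hk₁, rfl, hst⟩
    · have hlt := (h.step k₁).stepsLeft_lt hst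
      rw [hloc, hd] at hlt
      obtain ⟨k', hk', hcomp⟩ := ih _ hlt (k₁ + 1) rfl
      exact ⟨k', by omega, hcomp⟩

/-- A property that every `compNext` of `p` establishes and every step of `p` preserves holds
eventually, since `p` executes `compNext` infinitely often. -/
theorem eventually_of_stable (h : QuietRun n β L st who) (hp : p ∈ L)
    {P : LocalState m → ℕ → Prop}
    (hstep : ∀ᶠ k in atTop, ∀ l x, QuietStep n β p (st k) l x →
      ((st k).loc p).status = .compNext ∨ P ((st k).loc p) ((st k).next p) → P l x) :
    ∀ᶠ k in atTop, P ((st k).loc p) ((st k).next p) := by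
  obtain ⟨K, hK⟩ := eventually_atTop.1 hstep
  obtain ⟨k, hk, rfl, hst⟩ := h.exists_compNext hp K
  refine eventually_atTop.2 ⟨k + 1, fun j hj => ?_⟩
  induction j, hj using Nat.le_induction with
  | base => exact hK k hk _ _ (h.step k) (Or.inl hst)
  | succ j hj ih =>
    by_cases hw : who j = who k
    · exact hK j (by omega) _ _ (hw ▸ h.step j) (Or.inr ih)
    · rwa [h.loc_of_ne j _ hw, h.next_of_ne j _ hw]

theorem pos_eq_of_not_read (h : QuietRun n β L st who) (hjp : j ≠ p) (k : ℕ)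
    (hread : ¬ (j ≠ p ∧ ((st k).loc p).pos j ≤ n ∧ 0 < (st k).done j (((st k).loc p).pos j))) :
    ((st 0).loc p).pos j = ((st 0).loc j).pos j := by
  rw [← h.pos_eq k p, ← h.pos_eq k j]
  exact (h.inv k).pos_eq_of_not_read hjp hread

theorem pos_eq_diag (h : QuietRun n β L st who) (hp : p ∈ L) (j : Fin m) :
    ((st 0).loc p).pos j = ((st 0).loc j).pos j := by
  rcases eq_or_ne j p with rfl | hjp
  · rfl
  have hvisited := h.eventually_of_stable hp (P := fun l _ =>
    j ∈ l.visited .gatherDone → ((st 0).loc p).pos j = ((st 0).loc j).pos j) <|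
      Eventually.of_forall fun k l x hs hP => by
    cases hs with
    | compNext hst hβ =>
      rw [LocalState.visited_of_phase_gt (by simp [LocalState.compNext_of_le hβ, Status.phase])]
      simp
    | setNext hst =>
      rw [LocalState.visited_of_phase_gt (by simp [Status.phase])]
      simp
    | gatherTry hst =>
      intro hj
      rw [LocalState.gatherTry_eq] at hj
      change j ∈ (((st k).loc p).advance .gatherDone).visited .gatherDone at hj
      rw [LocalState.visited_advance_self (by simp [hst, Status.phase])] at hj
      simp at hj
    | gatherDone hst hread =>
      rw [← hst, LocalState.visited_advance (by simp [hst, Status.phase]), mem_Iic]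
      intro hj
      rcases hj.lt_or_eq with hlt | rfl
      · exact hP.resolve_left (by simp [hst]) (by
          rwa [LocalState.visited_of_status_eq hst, mem_Iio])
      · exact h.pos_eq_of_not_read hjp k hread
    | check hst =>
      exact fun _ => hP.resolve_left (by simp [hst]) (by
        rw [LocalState.visited_of_phase_lt (by simp [hst, Status.phase])]
        exact mem_univ j)
  obtain ⟨K, hK⟩ := eventually_atTop.1 hvisited
  obtain ⟨k, hk, -, hst⟩ := h.exists_compNext hp K
  refine hK k hk ?_
  rw [LocalState.visited_of_phase_lt (by simp [hst, Status.phase])]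
  exact mem_univ j

theorem free_eq_free (h : QuietRun n β L st who) (hp : p ∈ L) (hq : q ∈ L) :
    ((st 0).loc p).free = ((st 0).loc q).free := by
  rw [((h.inv 0).loc p).free_eq, ((h.inv 0).loc q).free_eq]
  congr 1
  ext z
  simp only [(h.inv 0).log.mem_known, h.pos_eq_diag hp, h.pos_eq_diag hq]

theorem eventually_next_mem_try (h : QuietRun n β L st who) (hp : p ∈ L) (hj : j ∉ L) :
    ∀ᶠ k in atTop, ((st k).loc p).status = .compNext → (st 0).next j ∈ ((st k).loc p).try_ := by
  have hjp : j ≠ p := fun e => hj (e ▸ hp)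
  have hvisited := h.eventually_of_stable hp (P := fun l _ =>
    j ∈ l.visited .gatherTry → (st 0).next j ∈ l.try_) <| Eventually.of_forall fun k l x hs hP => by
    have hpast : Status.gatherTry.phase < ((st k).loc p).status.phase →
        ((st k).loc p).status ≠ .compNext → (st 0).next j ∈ ((st k).loc p).try_ := fun hlt hne =>
      hP.resolve_left hne (by rw [LocalState.visited_of_phase_lt hlt]; exact mem_univ j)
    cases hs with
    | compNext hst hβ =>
      rw [LocalState.visited_of_phase_gt (by simp [LocalState.compNext_of_le hβ, Status.phase])]
      simp
    | setNext hst =>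
      rw [LocalState.visited_of_status_eq rfl, mem_Iio]
      simp [Fin.lt_def, ((h.inv k).loc p).q_eq_zero hst]
    | gatherTry hst =>
      rw [LocalState.mem_gatherTry_try _ (h.inv k).next_le, LocalState.gatherTry_eq]
      change j ∈ (((st k).loc p).advance .gatherDone).visited .gatherTry → _
      rw [← hst, LocalState.visited_advance (by simp [hst, Status.phase]), mem_Iic]
      intro hle
      rcases hle.lt_or_eq with hlt | rfl
      · exact Or.inl (hP.resolve_left (by simp [hst]) (by
          rwa [LocalState.visited_of_status_eq hst, mem_Iio]))
      · exact Or.inr ⟨hjp, (h.next_eq k hj).symm⟩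
    | gatherDone hst =>
      rw [LocalState.advance_try]
      exact fun _ => hpast (by simp [hst, Status.phase]) (by simp [hst])
    | check hst => exact fun _ => hpast (by simp [hst, Status.phase]) (by simp [hst])
  filter_upwards [hvisited] with k hk hst
  refine hk ?_
  rw [LocalState.visited_of_phase_lt (by simp [hst, Status.phase])]
  exact mem_univ j

theorem eventually_nxt (h : QuietRun n β L st who) (hp : p ∈ L) {Q : ℕ → Prop}
    (hQ : ∀ᶠ k in atTop, ((st k).loc p).status = .compNext →
      β ≤ #(((st k).loc p).free \ ((st k).loc p).try_) →
      Q (elementOfRank (((st k).loc p).free \ ((st k).loc p).try_)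
        (chosenRank m #((st k).loc p).free p))) :
    ∀ᶠ k in atTop, Q ((st k).loc p).nxt := by
  refine h.eventually_of_stable hp (P := fun l _ => Q l.nxt) ?_
  filter_upwards [hQ] with k hk l x hs hP
  cases hs with
  | compNext hst hβ =>
    rw [LocalState.compNext_of_le hβ]
    exact hk hst hβ
  | gatherTry hst => simpa [LocalState.gatherTry_eq, hst] using hP
  | _ hst => simpa [hst] using hP

theorem eventually_next (h : QuietRun n β L st who) (hp : p ∈ L) {Q : ℕ → Prop}
    (hQ : ∀ᶠ k in atTop, Q ((st k).loc p).nxt) : ∀ᶠ k in atTop, Q ((st k).next p) := by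
  have hannounced : ∀ᶠ k in atTop, ((st k).loc p).status ≠ .setNext → Q ((st k).next p) := by
    refine h.eventually_of_stable hp (P := fun l x => l.status ≠ .setNext → Q x) ?_
    filter_upwards [hQ] with k hk l x hs hP
    cases hs with
    | compNext _ hβ => simp [LocalState.compNext_of_le hβ]
    | setNext => exact fun _ => hk
    | _ hst => exact fun _ => hP.resolve_left (by simp [hst]) (by simp [hst])
  refine h.eventually_of_stable hp (P := fun _ x => Q x) ?_
  filter_upwards [hQ, hannounced] with k hk hk' l x hs _
  cases hs with
  | setNext => exact hk
  | _ hst => exact hk' (by simp [hst])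

theorem eventually_try (h : QuietRun n β L st who) (hp : p ∈ L) {Q : ℕ → Prop}
    (hQ : ∀ᶠ k in atTop, ∀ j ≠ p, Q ((st k).next j)) :
    ∀ᶠ k in atTop, ∀ z ∈ ((st k).loc p).try_, Q z := by
  refine h.eventually_of_stable hp (P := fun l _ => ∀ z ∈ l.try_, Q z) ?_
  filter_upwards [hQ] with k hk l x hs hP
  cases hs with
  | compNext _ hβ => simp [LocalState.compNext_of_le hβ]
  | gatherTry hst =>
    intro z
    rw [LocalState.mem_gatherTry_try _ (h.inv k).next_le]
    rintro (hz | ⟨hz, rfl⟩)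
    · exact hP.resolve_left (by simp [hst]) z hz
    · exact hk _ hz
  | _ hst => simpa [hst] using hP

/-- The free jobs of `p` that no process outside `L` has announced, at the beginning of the run
`st`. -/
def available (L : Finset (Fin m)) (st : ℕ → State m) (p : Fin m) : Finset ℕ :=
  ((st 0).loc p).free \ Lᶜ.image (st 0).next

theorem available_eq (h : QuietRun n β L st who) (hp : p ∈ L) (hq : q ∈ L) :
    available L st p = available L st q := by
  rw [available, available, h.free_eq_free hp hq]

theorem eventually_announced_subset_try (h : QuietRun n β L st who) (hp : p ∈ L) :
    ∀ᶠ k in atTop, ((st k).loc p).status = .compNext →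
      Lᶜ.image (st 0).next ⊆ ((st k).loc p).try_ := by
  have hall : ∀ᶠ k in atTop, ∀ j ∈ Lᶜ,
      ((st k).loc p).status = .compNext → (st 0).next j ∈ ((st k).loc p).try_ :=
    (eventually_all_finset _).2 fun j hj => h.eventually_next_mem_try hp (mem_compl.1 hj)
  filter_upwards [hall] with k hk hst
  exact image_subset_iff.2 fun j hj => hk j hj hst

theorem eventually_le_count_next (h : QuietRun n β L st who) (hβ : m ≤ β) (hp : p ∈ L) :
    ∀ᶠ k in atTop, chosenRank m #((st 0).loc p).free p ≤
      Nat.count (· ∈ available L st p) ((st k).next p) + 1 := by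
  let Q : ℕ → Prop := fun x =>
    chosenRank m #((st 0).loc p).free p ≤ Nat.count (· ∈ available L st p) x + 1
  refine h.eventually_next hp (Q := Q) (h.eventually_nxt hp (Q := Q) ?_)
  filter_upwards [h.eventually_announced_subset_try hp] with k hk hst hcard
  have hrank := count_elementOfRank (one_le_chosenRank _ _ _)
    (((h.inv k).loc p).chosenRank_le_card hβ hcard)
  rw [h.free_eq k p] at hrank ⊢
  refine hrank.ge.trans (Nat.succ_le_succ (Nat.count_mono_left fun z _ hz => ?_))
  exact sdiff_subset_sdiff subset_rfl (hk hst) hz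

theorem chosenRank_le_card_available (h : QuietRun n β L st who) (hβ : m ≤ β) (hp : p ∈ L) :
    chosenRank m #((st 0).loc p).free p ≤ #(available L st p) := by
  obtain ⟨K, hK⟩ := eventually_atTop.1 (h.eventually_announced_subset_try hp)
  obtain ⟨k, hk, rfl, hst⟩ := h.exists_compNext hp K
  have hs := h.step k
  generalize (st (k + 1)).loc (who k) = l, (st (k + 1)).next (who k) = x at hs
  cases hs with
  | compNext _ hcard =>
    have hrank := ((h.inv k).loc (who k)).chosenRank_le_card hβ hcard
    rw [h.free_eq k] at hrank
    exact hrank.trans (card_le_card (sdiff_subset_sdiff subset_rfl (hK k hk hst)))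
  | _ hst' => simp [hst] at hst'

/-- The selected rank grows with the identifier, so the other processes of `L` select available
jobs of higher rank than `p` does. -/
theorem eventually_try_subset (h : QuietRun n β L st who) (hβ : m ≤ β) (hp : p ∈ L)
    (hmin : ∀ q ∈ L, p ≤ q) :
    ∀ᶠ k in atTop, ∀ z ∈ ((st k).loc p).try_, z ∈ Lᶜ.image (st 0).next ∨
      chosenRank m #((st 0).loc p).free p ≤ Nat.count (· ∈ available L st p) z := by
  have hcount : ∀ᶠ k in atTop, ∀ q ∈ L, chosenRank m #((st 0).loc p).free q ≤
      Nat.count (· ∈ available L st p) ((st k).next q) + 1 :=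
    (eventually_all_finset _).2 fun q hq => by
      simpa only [h.available_eq hq hp, h.free_eq_free hq hp] using h.eventually_le_count_next hβ hq
  refine h.eventually_try hp ?_
  filter_upwards [hcount] with k hk q hqp
  by_cases hq : q ∈ L
  · have hrank : chosenRank m #((st 0).loc p).free p < chosenRank m #((st 0).loc p).free q :=
      chosenRank_strictMono m _ (Fin.lt_def.1 (lt_of_le_of_ne (hmin q hq) hqp.symm))
    exact Or.inr (Nat.le_of_lt_succ (hrank.trans_le (hk q hq)))
  · exact Or.inl (mem_image.2 ⟨q, mem_compl.2 hq, (h.next_eq k hq).symm⟩)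

theorem eventually_nxt_eq (h : QuietRun n β L st who) (hβ : m ≤ β) (hp : p ∈ L)
    (hmin : ∀ q ∈ L, p ≤ q) :
    ∀ᶠ k in atTop, ((st k).loc p).nxt =
      elementOfRank (available L st p) (chosenRank m #((st 0).loc p).free p) := by
  refine h.eventually_nxt hp (Q := (· = _)) ?_
  filter_upwards [h.eventually_announced_subset_try hp, h.eventually_try_subset hβ hp hmin]
    with k hsub htry hst _
  rw [h.free_eq k p]
  exact elementOfRank_sdiff_eq (hsub hst) (one_le_chosenRank _ _ _)
    (h.chosenRank_le_card_available hβ hp) htry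

theorem eventually_no_conflict (h : QuietRun n β L st who) (hβ : m ≤ β) (hp : p ∈ L)
    (hmin : ∀ q ∈ L, p ≤ q) :
    ∀ᶠ k in atTop, ((st k).loc p).nxt ∉ ((st k).loc p).try_ ∧
      ((st k).loc p).nxt ∉ ((st k).loc p).done := by
  have hone := one_le_chosenRank m #((st 0).loc p).free p
  have hcard := h.chosenRank_le_card_available hβ hp
  obtain ⟨hfree, hnot⟩ := Finset.mem_sdiff.1 (elementOfRank_mem hone hcard)
  filter_upwards [h.eventually_try_subset hβ hp hmin, h.eventually_nxt_eq hβ hp hmin]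
    with k htry hnxt
  rw [hnxt]
  constructor
  · intro hmem
    have hcount := (htry _ hmem).resolve_left hnot
    have := count_elementOfRank hone hcard
    omega
  · have hsub : ((st 0).loc p).free ⊆ Icc 1 n \ ((st k).loc p).done := by
      rw [← h.free_eq k p, ((h.inv k).loc p).free_eq]
    exact (Finset.mem_sdiff.1 (hsub hfree)).2

theorem elim (h : QuietRun n β L st who) (hβ : m ≤ β) : False := by
  obtain ⟨p, hp, hmin⟩ := exists_min_image L id ⟨who 0, h.who_mem 0⟩
  have hne : ∀ᶠ k in atTop, ((st k).loc p).status ≠ .compNext := by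
    refine h.eventually_of_stable hp (P := fun l _ => l.status ≠ .compNext) ?_
    filter_upwards [h.eventually_no_conflict hβ hp hmin] with k hk l x hs _
    cases hs with
    | compNext _ hcard => simp [LocalState.compNext_of_le hcard]
    | setNext => simp
    | gatherTry hst =>
      rw [LocalState.gatherTry_eq]
      rcases ((st k).loc p).advance_status_eq_or .gatherDone with h' | h' <;> simp [h', hst]
    | gatherDone hst =>
      rcases ((st k).loc p).advance_status_eq_or .check with h' | h' <;> simp [h', hst]
    | check _ hconflict => exact absurd hconflict (not_or.2 hk)
  obtain ⟨K, hK⟩ := eventually_atTop.1 hne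
  obtain ⟨k, hk, -, hst⟩ := h.exists_compNext hp K
  exact hK k hk hst

end QuietRun

/-! ### Every execution is finite -/

/-- The process that takes a given action. -/
def Action.actor : Action m → Fin m
  | .crash p | .compNext p | .setNext p | .gatherTry p | .gatherDone p | .check p | .perform p _
  | .record p => p

/-- The statuses in which the actor can take a given action. -/
def Action.source : Action m → Set Status
  | .crash _ => {.stopped}ᶜ
  | .compNext _ => {.compNext}
  | .setNext _ => {.setNext}
  | .gatherTry _ => {.gatherTry}
  | .gatherDone _ => {.gatherDone}
  | .check _ => {.check}
  | .perform _ _ => {.perform}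
  | .record _ => {.record}

/-- The statuses to which a given action can lead its actor. -/
def Action.target : Action m → Set Status
  | .crash _ => {.stopped}
  | .compNext _ => {.setNext, .finished}
  | .setNext _ => {.gatherTry}
  | .gatherTry _ => {.gatherTry, .gatherDone}
  | .gatherDone _ => {.gatherDone, .check}
  | .check _ => {.perform, .compNext}
  | .perform _ _ => {.record}
  | .record _ => {.compNext}

section Trans

variable {s s' : State m} {a : Action m} {p : Fin m}

theorem trans_of_actor_ne (h : trans n m β s a s') (hp : p ≠ a.actor) :
    s'.loc p = s.loc p ∧ s'.next p = s.next p ∧ s'.done p = s.done p := by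
  cases a <;> simp only [trans, Action.actor] at h hp
  case perform => obtain ⟨_, _, rfl⟩ := h; simp [State.setLoc, hp]
  all_goals obtain ⟨_, rfl⟩ := h; simp [State.setLoc, hp]

theorem status_mem_source (h : trans n m β s a s') : (s.loc a.actor).status ∈ a.source := by
  cases a <;> exact h.1

theorem status_mem_target (h : trans n m β s a s') : (s'.loc a.actor).status ∈ a.target := by
  cases a with
  | compNext p =>
    obtain ⟨-, rfl⟩ := h
    simp only [Action.actor, Action.target, State.setLoc_loc_self, LocalState.compNext]
    split_ifs <;> simp
  | gatherTry p =>
    obtain ⟨hst, rfl⟩ := h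
    have := (s.loc p).advance_status_eq_or .gatherDone
    simpa [Action.actor, Action.target, LocalState.gatherTry_eq, hst] using this
  | gatherDone p =>
    obtain ⟨hst, rfl⟩ := h
    have := (s.loc p).advance_status_eq_or .check
    simp only [Action.actor, Action.target, State.setLoc_loc_self, LocalState.gatherDone]
    split_ifs
    · simp [hst]
    · simpa [hst] using this
  | check p =>
    obtain ⟨-, rfl⟩ := h
    simp only [Action.actor, Action.target, State.setLoc_loc_self, LocalState.check]
    split_ifs <;> simp
  | perform p j =>
    obtain ⟨-, -, rfl⟩ := h
    simp [Action.actor, Action.target]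
  | _ p =>
    obtain ⟨-, rfl⟩ := h
    simp [Action.actor, Action.target, State.setLoc, LocalState.record]

theorem pos_mono_of_trans (h : trans n m β s a s') (p : Fin m) :
    (s.loc p).pos ≤ (s'.loc p).pos := by
  by_cases hp : p = a.actor
  swap
  · rw [(trans_of_actor_ne h hp).1]
  have hupdate (f : Fin m → ℕ) (q : Fin m) : f ≤ Function.update f q (f q + 1) :=
    le_update_self_iff.2 (Nat.le_succ _)
  subst hp
  cases a with
  | compNext p =>
    obtain ⟨-, rfl⟩ := h
    simp only [Action.actor, State.setLoc_loc_self, LocalState.compNext]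
    split_ifs <;> exact le_rfl
  | gatherTry p =>
    obtain ⟨-, rfl⟩ := h
    simp [Action.actor, LocalState.gatherTry_eq]
  | gatherDone p =>
    obtain ⟨-, rfl⟩ := h
    simp only [Action.actor, State.setLoc_loc_self, LocalState.gatherDone]
    split_ifs
    · exact hupdate _ _
    · rw [LocalState.advance_pos]
  | check p =>
    obtain ⟨-, rfl⟩ := h
    simp only [Action.actor, State.setLoc_loc_self, LocalState.check]
    split_ifs <;> exact le_rfl
  | perform p j =>
    obtain ⟨-, -, rfl⟩ := h
    simp [Action.actor]
  | record p =>
    obtain ⟨-, rfl⟩ := h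
    simp [Action.actor, State.setLoc, LocalState.record]
  | _ p =>
    obtain ⟨-, rfl⟩ := h
    simp [Action.actor, State.setLoc]

theorem pos_ne_of_record (h : trans n m β s (.record p) s') : (s'.loc p).pos ≠ (s.loc p).pos := by
  obtain ⟨-, rfl⟩ := h
  intro heq
  simpa [State.setLoc, LocalState.record] using congrFun heq p

theorem quietStep_of_trans (h : trans n m β s a s')
    (hsource : (s.loc a.actor).status ∉ ({.perform, .record} : Set Status))
    (htarget : (s'.loc a.actor).status ∉ ({.perform, .finished, .stopped} : Set Status))
    (hpos : (s'.loc a.actor).pos = (s.loc a.actor).pos) :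
    QuietStep n β a.actor s (s'.loc a.actor) (s'.next a.actor) := by
  cases a <;> simp only [Action.actor] at hsource htarget hpos ⊢
  case crash p =>
    obtain ⟨-, rfl⟩ := h
    simp at htarget
  case compNext p =>
    obtain ⟨hst, rfl⟩ := h
    rw [State.setLoc_loc_self] at htarget ⊢
    refine .compNext hst (not_lt.1 fun hlt => htarget ?_)
    simp [LocalState.compNext, hlt.not_ge]
  case setNext p =>
    obtain ⟨hst, rfl⟩ := h
    simpa [State.setLoc] using QuietStep.setNext hst
  case gatherTry p =>
    obtain ⟨hst, rfl⟩ := h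
    rw [State.setLoc_loc_self]
    exact .gatherTry hst
  case gatherDone p =>
    obtain ⟨hst, rfl⟩ := h
    simp only [State.setLoc_loc_self, LocalState.gatherDone] at hpos ⊢
    split_ifs at hpos ⊢ with hread
    · simpa using congrFun hpos (s.loc p).q
    · exact .gatherDone hst hread
  case check p =>
    obtain ⟨hst, rfl⟩ := h
    simp only [State.setLoc_loc_self, LocalState.check] at htarget ⊢
    split_ifs at htarget ⊢ with hconflict
    · simp at htarget
    · exact .check hst (by tauto)
  case perform p j => simp [h.1] at hsource
  case record p => simp [h.1] at hsource

end Trans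

/-- An infinite sequence of transitions between states that satisfy the invariants. -/
structure InfiniteRun (n β : ℕ) (st : ℕ → State m) (act : ℕ → Action m) : Prop where
  inv : ∀ k, Inv n β (st k)
  step : ∀ k, trans n m β (st k) (act k) (st (k + 1))

namespace InfiniteRun

variable {st : ℕ → State m} {act : ℕ → Action m} {p : Fin m}

theorem exists_step (h : InfiniteRun n β st act) (hp : ∃ᶠ k in atTop, (act k).actor = p) (k : ℕ) :
    ∃ k' ≥ k, (act k').actor = p ∧ (st k').loc p = (st k).loc p :=
  exists_ge_eq_of_frequently hp (f := fun k => (st k).loc p)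
    (fun k hk => (trans_of_actor_ne (h.step k) hk.symm).1) k

theorem status_ne_stopped (h : InfiniteRun n β st act)
    (hp : ∃ᶠ k in atTop, (act k).actor = p) (k : ℕ) : ((st k).loc p).status ≠ .stopped := by
  obtain ⟨k', -, rfl, hloc⟩ := h.exists_step hp k
  have hsource := status_mem_source (h.step k')
  rw [← hloc]
  intro hst
  rw [hst] at hsource
  generalize act k' = a at hsource
  cases a <;> simp [Action.source] at hsource

theorem act_ne_crash (h : InfiniteRun n β st act) (hp : ∃ᶠ k in atTop, (act k).actor = p)
    (k : ℕ) : act k ≠ .crash p := by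
  intro hk
  have htarget := status_mem_target (h.step k)
  rw [hk] at htarget
  exact h.status_ne_stopped hp (k + 1) htarget

theorem exists_step_source (h : InfiniteRun n β st act)
    (hp : ∃ᶠ k in atTop, (act k).actor = p) (k : ℕ) :
    ∃ k' ≥ k, (act k').actor = p ∧ ((st k).loc p).status ∈ (act k').source ∧
      act k' ≠ .crash p := by
  obtain ⟨k', hk', rfl, hloc⟩ := h.exists_step hp k
  exact ⟨k', hk', rfl, hloc ▸ status_mem_source (h.step k'), h.act_ne_crash hp k'⟩

theorem status_ne_finished (h : InfiniteRun n β st act)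
    (hp : ∃ᶠ k in atTop, (act k).actor = p) (k : ℕ) : ((st k).loc p).status ≠ .finished := by
  obtain ⟨k', -, rfl, hsource, hcrash⟩ := h.exists_step_source hp k
  intro hst
  rw [hst] at hsource
  generalize act k' = a at hsource hcrash
  cases a <;> simp [Action.source, Action.actor] at hsource hcrash

theorem exists_record (h : InfiniteRun n β st act) (hp : ∃ᶠ k in atTop, (act k).actor = p)
    {k : ℕ} (hst : ((st k).loc p).status = .record) : ∃ k' ≥ k, act k' = .record p := by
  obtain ⟨k', hk', rfl, hsource, hcrash⟩ := h.exists_step_source hp k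
  refine ⟨k', hk', ?_⟩
  rw [hst] at hsource
  generalize act k' = a at hsource hcrash
  cases a <;> simp_all [Action.source, Action.actor]

theorem exists_record_of_perform (h : InfiniteRun n β st act)
    (hp : ∃ᶠ k in atTop, (act k).actor = p) {k : ℕ} (hst : ((st k).loc p).status = .perform) :
    ∃ k' ≥ k, act k' = .record p := by
  obtain ⟨k', hk', rfl, hsource, hcrash⟩ := h.exists_step_source hp k
  have htarget := status_mem_target (h.step k')
  obtain ⟨k'', hk'', hrec⟩ := h.exists_record hp (k := k' + 1) (by
    rw [hst] at hsource
    generalize (act k') = a at hsource hcrash htarget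
    cases a <;> simp_all [Action.source, Action.target, Action.actor])
  exact ⟨k'', by omega, hrec⟩

theorem eventually_pos_eq (h : InfiniteRun n β st act) :
    ∀ᶠ k in atTop, ∀ p, ((st (k + 1)).loc p).pos = ((st k).loc p).pos := by
  have hpos : ∀ᶠ k in atTop, ∀ p q, ((st (k + 1)).loc p).pos q = ((st k).loc p).pos q := by
    refine eventually_all.2 fun p => eventually_all.2 fun q => ?_
    obtain ⟨b, K, hK⟩ := converges_of_monotone_of_bounded (f := fun k => ((st k).loc p).pos q)
      (c := n + 1) (monotone_nat_of_le_succ fun k => pos_mono_of_trans (h.step k) p q) fun k =>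
        ((h.inv k).log.pos_le_diag p q).trans
          (le_of_add_le_left ((h.inv k).loc q).pos_add_card_le)
    filter_upwards [eventually_ge_atTop K] with k hk
    exact (hK _ (by omega)).trans (hK k hk).symm
  filter_upwards [hpos] with k hk p using funext (hk p)

theorem eventually_frequently_actor :
    ∀ᶠ k in atTop, ∃ᶠ j in atTop, (act j).actor = (act k).actor := by
  have hrare : ∀ᶠ k in atTop, ∀ p, ¬ (∃ᶠ j in atTop, (act j).actor = p) → (act k).actor ≠ p :=
    eventually_all.2 fun p => by
      by_cases hp : ∃ᶠ j in atTop, (act j).actor = p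
      · simp [hp]
      · simpa [hp] using not_frequently.1 hp
  filter_upwards [hrare] with k hk
  by_contra hp
  exact hk _ hp rfl

theorem exists_quietRun (h : InfiniteRun n β st act) :
    ∃ L K, QuietRun n β L (fun k => st (k + K)) fun k => (act (k + K)).actor := by
  classical
  obtain ⟨K, hK⟩ := eventually_atTop.1
    (h.eventually_pos_eq.and (eventually_frequently_actor (act := act)))
  have hno_record {p : Fin m} {k : ℕ} (hk : K ≤ k) : ¬ ∃ k' ≥ k, act k' = .record p := by
    rintro ⟨k', hk', hrec⟩
    exact pos_ne_of_record (hrec ▸ h.step k') ((hK k' (hk.trans hk')).1 p)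
  have hno_perform {p : Fin m} (hp : ∃ᶠ k in atTop, (act k).actor = p) {k : ℕ} (hk : K ≤ k) :
      ((st k).loc p).status ≠ .perform :=
    fun hst => hno_record hk (h.exists_record_of_perform hp hst)
  refine ⟨univ.filter fun p => ∃ᶠ k in atTop, (act k).actor = p, K, fun k => h.inv _,
    fun k => ?_, fun p hp => ?_, fun k => ?_, fun k q hq => ?_, fun k q hq => ?_⟩
  · exact mem_filter.2 ⟨mem_univ _, (hK (k + K) (Nat.le_add_left K k)).2⟩
  · have hactor := (mem_filter.1 hp).2
    rwa [← map_add_atTop_eq_nat K, frequently_map] at hactor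
  · have hk : K ≤ k + K := Nat.le_add_left K k
    have hp := (hK (k + K) hk).2
    rw [show k + 1 + K = k + K + 1 by omega]
    refine quietStep_of_trans (h.step (k + K)) ?_ ?_ ((hK (k + K) hk).1 _)
    · rintro (hst | hst)
      · exact hno_perform hp hk hst
      · exact hno_record hk (h.exists_record hp hst)
    · rintro (hst | hst | hst)
      · exact hno_perform hp (by omega) hst
      · exact h.status_ne_finished hp _ hst
      · exact h.status_ne_stopped hp _ hst
  all_goals rw [show k + 1 + K = k + K + 1 by omega]
  · exact (trans_of_actor_ne (h.step (k + K)) hq.symm).1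
  · exact (trans_of_actor_ne (h.step (k + K)) hq.symm).2.1

end InfiniteRun

theorem Execution.len_ne_top (hβ : m ≤ β) (e : Execution (algorithm n m β)) : e.len ≠ ⊤ := by
  intro hlen
  have hrun : InfiniteRun n β e.state e.act :=
    ⟨fun k => e.inv hβ k (by simp [hlen]), fun k => e.step k (by simp [hlen])⟩
  obtain ⟨L, K, hquiet⟩ := hrun.exists_quietRun
  exact hquiet.elim hβ

/-! ### The lower bound -/

section Trans

variable {s s' : State m} {a : Action m} {p : Fin m}

theorem eq_crash_of_trans (h : trans n m β s a s') (hs : (s.loc p).status ≠ .stopped)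
    (hs' : (s'.loc p).status = .stopped) : a = .crash p := by
  obtain rfl : p = a.actor := by
    by_contra hp
    exact hs ((trans_of_actor_ne h hp).1 ▸ hs')
  have htarget := status_mem_target h
  rw [hs'] at htarget
  cases a <;> simp_all [Action.target, Action.actor]

theorem eq_perform_of_trans {x : ℕ} (h : trans n m β s a s')
    (hs : ¬ ((s.loc p).status = .record ∧ (s.loc p).nxt = x))
    (hs' : (s'.loc p).status = .record ∧ (s'.loc p).nxt = x) : a = .perform p x := by
  obtain rfl : p = a.actor := by
    by_contra hp
    exact hs ((trans_of_actor_ne h hp).1 ▸ hs')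
  have htarget := status_mem_target h
  rw [hs'.1] at htarget
  cases a with
  | perform p j =>
    obtain ⟨-, rfl, rfl⟩ := h
    simpa [Action.actor] using hs'.2
  | _ => simp [Action.target] at htarget

theorem status_eq_record_of_trans {i x : ℕ} (h : trans n m β s a s') (hs : s.done p i ≠ x)
    (hs' : s'.done p i = x) : (s.loc p).status = .record ∧ (s.loc p).nxt = x := by
  cases a with
  | record q =>
    obtain ⟨hst, rfl⟩ := h
    simp only [Function.update_apply] at hs'
    split_ifs at hs' with hq
    · subst hq
      simp only [Function.update_apply] at hs'
      split_ifs at hs' with hi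
      · exact ⟨hst, hs'⟩
      · exact absurd hs' hs
    · exact absurd hs' hs
  | perform q j =>
    obtain ⟨-, -, rfl⟩ := h
    exact absurd hs' hs
  | _ q =>
    obtain ⟨-, rfl⟩ := h
    exact absurd hs' hs

end Trans

theorem Execution.exists_step_of_state {σ α : Type} {A : Automaton σ α} (e : Execution A)
    {P : σ → Prop} (hstart : ∀ s ∈ A.start, ¬ P s) {k : ℕ} (hk : (k : ℕ∞) ≤ e.len)
    (hP : P (e.state k)) :
    ∃ j : ℕ, (j : ℕ∞) < e.len ∧ A.trans (e.state j) (e.act j) (e.state (j + 1)) ∧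
      ¬ P (e.state j) ∧ P (e.state (j + 1)) := by
  induction k with
  | zero => exact absurd hP (hstart _ e.start_mem)
  | succ k ih =>
    have hlt : (k : ℕ∞) < e.len := lt_of_lt_of_le (by exact_mod_cast Nat.lt_succ_self k) hk
    by_cases hk' : P (e.state k)
    · exact ih hlt.le hk'
    · exact ⟨k, hlt, e.step k hlt, hk', hP⟩

section Occurs

variable {k : ℕ} {p : Fin m} {i x : ℕ}

theorem Execution.occurs_crash (e : Execution (algorithm n m β)) (hk : (k : ℕ∞) ≤ e.len)
    (h : ((e.state k).loc p).status = .stopped) : e.Occurs (.crash p) := by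
  obtain ⟨j, hj, htrans, hs, hs'⟩ := e.exists_step_of_state
    (P := fun s => (s.loc p).status = .stopped) (by simp [algorithm, initState]) hk h
  exact ⟨j, hj, eq_crash_of_trans htrans hs hs'⟩

theorem Execution.occurs_perform_of_record (e : Execution (algorithm n m β))
    (hk : (k : ℕ∞) ≤ e.len)
    (h : ((e.state k).loc p).status = .record ∧ ((e.state k).loc p).nxt = x) :
    e.Occurs (.perform p x) := by
  obtain ⟨j, hj, htrans, hs, hs'⟩ := e.exists_step_of_state
    (P := fun s => (s.loc p).status = .record ∧ (s.loc p).nxt = x)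
    (by simp [algorithm, initState]) hk h
  exact ⟨j, hj, eq_perform_of_trans htrans hs hs'⟩

theorem Execution.occurs_perform_of_done (e : Execution (algorithm n m β))
    (hk : (k : ℕ∞) ≤ e.len) (hx : 0 < x) (h : (e.state k).done p i = x) :
    e.Occurs (.perform p x) := by
  obtain ⟨j, hj, htrans, hs, hs'⟩ := e.exists_step_of_state
    (P := fun s => s.done p i = x) (by simpa [algorithm, initState] using hx.ne) hk h
  exact e.occurs_perform_of_record hj.le (status_eq_record_of_trans htrans hs hs')

end Occurs

theorem exists_enabled {s : State m} {p : Fin m}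
    (hp : (s.loc p).status ∉ ({.finished, .stopped} : Set Status)) :
    ∃ a, (algorithm n m β).isLocal a ∧ (algorithm n m β).Enabled s a := by
  cases h : (s.loc p).status with
  | compNext => exact ⟨.compNext p, by simp [algorithm], _, h, rfl⟩
  | setNext => exact ⟨.setNext p, by simp [algorithm], _, h, rfl⟩
  | gatherTry => exact ⟨.gatherTry p, by simp [algorithm], _, h, rfl⟩
  | gatherDone => exact ⟨.gatherDone p, by simp [algorithm], _, h, rfl⟩
  | check => exact ⟨.check p, by simp [algorithm], _, h, rfl⟩
  | perform => exact ⟨.perform p _, by simp [algorithm], _, h, rfl, rfl⟩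
  | record => exact ⟨.record p, by simp [algorithm], _, h, rfl⟩
  | finished => simp [h] at hp
  | stopped => simp [h] at hp

theorem card_known_le_numDone (hβ : m ≤ β) (e : Execution (algorithm n m β)) {k : ℕ}
    (hk : (k : ℕ∞) ≤ e.len) (p : Fin m) :
    #(Icc 1 n ∩ ((e.state k).loc p).done) ≤ numDone n e := by
  rw [numDone, ← Set.ncard_coe_finset]
  refine Set.ncard_le_ncard (fun j hj => ?_)
    ((finite_toSet (Icc 1 n)).subset fun j hj => hj.1)
  obtain ⟨hjn, hjdone⟩ := mem_inter.1 (mem_coe.1 hj)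
  obtain ⟨q, i, -, -, hcell⟩ := ((e.inv hβ k hk).log.mem_known p j).1 hjdone
  exact ⟨hjn, q, e.occurs_perform_of_done hk (mem_Icc.1 hjn).1 hcell⟩

theorem LocalInv.card_free_le_of_finished {p : Fin m} {l : LocalState m} (hl : LocalInv n β p l)
    (h : l.status = .finished) : #l.free ≤ β + m - 2 := by
  have hfree := hl.card_lt_of_finished h
  have htry := hl.card_try_le_pred
  have hsdiff := le_card_sdiff l.try_ l.free
  have hm := p.pos
  omega

theorem le_numDone {f : ℕ} (hβ : m ≤ β) (hf : f < m) {e : Execution (algorithm n m β)}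
    (he : e ∈ fairExecs (algorithm n m β) f) : n ≤ numDone n e + (β + m - 2) := by
  obtain ⟨⟨hfair, -⟩, hcrashed⟩ := he
  obtain ⟨r, hr⟩ := ENat.ne_top_iff_exists.1 (e.len_ne_top hβ)
  obtain ⟨p, hp⟩ : ∃ p, p ∉ crashed e := by
    by_contra! hall
    rw [Set.eq_univ_of_forall hall, Set.ncard_univ, Nat.card_fin] at hcrashed
    omega
  have hfinished : ((e.state r).loc p).status = .finished := by
    by_contra hst
    obtain ⟨a, ha, hen⟩ := exists_enabled (n := n) (β := β) (s := e.state r) (p := p) (by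
      rintro (h | h)
      · exact hst h
      · exact hp (e.occurs_crash hr.le h))
    exact hfair r hr.symm a ha hen
  have hl := (e.inv hβ r hr.le).loc p
  have hfree := hl.card_free_le_of_finished hfinished
  have hknown := card_known_le_numDone hβ e hr.le p
  have hsplit := card_sdiff_add_card_inter (Icc 1 n) ((e.state r).loc p).done
  rw [← hl.free_eq, Nat.card_Icc] at hsplit
  omega

/-! ### Reachability by restricted actions -/

section Reaches

variable {σ α : Type} {A : Automaton σ α}

/-- The automaton `A` can go from one state to another by actions with the property `P`. -/
def Automaton.Reaches (A : Automaton σ α) (P : α → Prop) : σ → σ → Prop :=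
  Relation.ReflTransGen fun s s' => ∃ a, P a ∧ A.trans s a s'

/-- The finite execution `e` of length `r`, continued by one transition. -/
def Execution.snoc (e : Execution A) {r : ℕ} (hr : e.len = r) {a : α} {s : σ}
    (h : A.trans (e.state r) a s) : Execution A where
  len := (r + 1 : ℕ)
  state := Function.update e.state (r + 1) s
  act := Function.update e.act r a
  start_mem := by
    rw [Function.update_of_ne r.succ_ne_zero.symm]
    exact e.start_mem
  step k hk := by
    have hk : k < r + 1 := by exact_mod_cast hk
    rcases (Nat.lt_succ_iff.1 hk).lt_or_eq with hlt | rfl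
    · rw [Function.update_of_ne (by omega), Function.update_of_ne (by omega),
        Function.update_of_ne (by omega)]
      exact e.step k (by rw [hr]; exact_mod_cast hlt)
    · rw [Function.update_of_ne (by omega), Function.update_self, Function.update_self]
      exact h

theorem Execution.Occurs.of_snoc {e : Execution A} {r : ℕ} {hr : e.len = r} {a b : α} {s : σ}
    {h : A.trans (e.state r) a s} (hb : (e.snoc hr h).Occurs b) : e.Occurs b ∨ b = a := by
  obtain ⟨k, hk, rfl⟩ := hb
  have hk : k < r + 1 := Nat.cast_lt.1 hk
  rcases (Nat.lt_succ_iff.1 hk).lt_or_eq with hlt | rfl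
  · exact Or.inl ⟨k, by rw [hr]; exact_mod_cast hlt, (Function.update_of_ne hlt.ne _ _).symm⟩
  · exact Or.inr (Function.update_self _ _ _)

theorem Automaton.Reaches.exists_execution [Nonempty α] {P : α → Prop} {s₀ s : σ}
    (h : A.Reaches P s₀ s) (hs₀ : s₀ ∈ A.start) :
    ∃ (e : Execution A) (r : ℕ), e.len = r ∧ e.state r = s ∧ ∀ a, e.Occurs a → P a := by
  induction h with
  | refl =>
    refine ⟨⟨0, fun _ => s₀, fun _ => Classical.arbitrary α, hs₀, by simp⟩, 0, rfl, rfl, ?_⟩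
    rintro a ⟨k, hk, -⟩
    simp at hk
  | tail _ hstep ih =>
    obtain ⟨e, r, hlen, rfl, hP⟩ := ih
    obtain ⟨a, ha, htrans⟩ := hstep
    refine ⟨e.snoc hlen htrans, r + 1, rfl, Function.update_self _ _ _, fun b hb => ?_⟩
    rcases hb.of_snoc with hb | rfl
    exacts [hP b hb, ha]

end Reaches

variable {J : Finset ℕ} {C : Finset (Fin m)}

/-- The actions that perform only jobs in `J` and crash only processes in `C`. -/
def Action.Allowed (J : Finset ℕ) (C : Finset (Fin m)) : Action m → Prop
  | .perform _ j => j ∈ J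
  | .crash p => p ∈ C
  | _ => True

/-- Reachability by transitions that perform only jobs in `J` and crash only processes in `C`. -/
def Reach (n β : ℕ) (J : Finset ℕ) (C : Finset (Fin m)) : State m → State m → Prop :=
  (algorithm n m β).Reaches (Action.Allowed J C)

namespace Reach

variable {s t u : State m}

theorem refl (s : State m) : Reach n β J C s s :=
  Relation.ReflTransGen.refl

theorem trans (h₁ : Reach n β J C s t) (h₂ : Reach n β J C t u) : Reach n β J C s u :=
  Relation.ReflTransGen.trans h₁ h₂

theorem single (a : Action m) (h : KK.trans n m β s a t) (ha : a.Allowed J C := by trivial) :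
    Reach n β J C s t :=
  Relation.ReflTransGen.single ⟨a, ha, h⟩

theorem inv (h : Reach n β J C s t) (hβ : m ≤ β) (hs : Inv n β s) : Inv n β t := by
  induction h with
  | refl => exact hs
  | tail _ hstep ih =>
    obtain ⟨a, -, ha⟩ := hstep
    exact ih.step hβ ha

end Reach

namespace State

@[simp] theorem setLoc_next (s : State m) (p : Fin m) (l : LocalState m) :
    (s.setLoc p l).next = s.next :=
  rfl

@[simp] theorem setLoc_setLoc (s : State m) (p : Fin m) (l l' : LocalState m) :
    (s.setLoc p l).setLoc p l' = s.setLoc p l' := by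
  simp [setLoc]

@[simp] theorem setLoc_loc (s : State m) (p : Fin m) : s.setLoc p (s.loc p) = s := by
  simp [setLoc]

/-- The state after the action `setNext` of process `p`. -/
def announce (s : State m) (p : Fin m) : State m :=
  { s.setLoc p { s.loc p with status := .gatherTry } with
    next := Function.update s.next p (s.loc p).nxt }

@[simp] theorem announce_loc_self (s : State m) (p : Fin m) :
    (s.announce p).loc p = { s.loc p with status := .gatherTry } :=
  setLoc_loc_self _ _ _

@[simp] theorem announce_loc_of_ne (s : State m) {p q : Fin m} (h : q ≠ p) :
    (s.announce p).loc q = s.loc q :=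
  setLoc_loc_of_ne s h _

@[simp] theorem announce_next_self (s : State m) (p : Fin m) :
    (s.announce p).next p = (s.loc p).nxt :=
  Function.update_self _ _ _

@[simp] theorem announce_next_of_ne (s : State m) {p q : Fin m} (h : q ≠ p) :
    (s.announce p).next q = s.next q :=
  Function.update_of_ne h _ _

/-- The jobs recorded in the shared matrix. -/
def recorded (s : State m) : Set ℕ :=
  {z | 0 < z ∧ ∃ q i, s.done q i = z}

@[simp] theorem setLoc_recorded (s : State m) (p : Fin m) (l : LocalState m) :
    (s.setLoc p l).recorded = s.recorded :=
  rfl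

@[simp] theorem announce_recorded (s : State m) (p : Fin m) :
    (s.announce p).recorded = s.recorded :=
  rfl

/-! ### One process running alone -/

/-- The value of `TRY` at the end of the current execution of the first gathering loop by `p`,
provided that the cells `next` do not change until then. -/
def finalTry (s : State m) (p : Fin m) : Set ℕ :=
  (s.loc p).try_ ∪ s.next '' {j | j ≠ p ∧ j ∉ (s.loc p).visited .gatherTry}

theorem finalTry_of_phase_lt {s : State m} {p : Fin m}
    (h : Status.gatherTry.phase < (s.loc p).status.phase) : s.finalTry p = (s.loc p).try_ := by
  simp [finalTry, LocalState.visited_of_phase_lt h]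

theorem finalTry_eq_image {s : State m} {p : Fin m} (hst : (s.loc p).status = .gatherTry)
    (hq : (s.loc p).q.val = 0) (htry : (s.loc p).try_ = ∅) : s.finalTry p = s.next '' {p}ᶜ := by
  have hvisited (j : Fin m) : j ∉ (s.loc p).visited .gatherTry := by
    rw [LocalState.visited_of_status_eq hst, mem_Iio, not_lt, Fin.le_def, hq]
    exact Nat.zero_le _
  simp only [finalTry, htry, hvisited, coe_empty, Set.empty_union, not_false_eq_true, and_true]
  rfl

end State

theorem Reach.announce {s : State m} {p : Fin m} (hst : (s.loc p).status = .setNext) :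
    Reach n β J C s (s.announce p) :=
  .single (.setNext p) ⟨hst, rfl⟩

namespace Inv

variable {s : State m} {p : Fin m}

theorem coe_done_eq_recorded (hs : Inv n β s) (hpos : ∀ j, (s.loc p).pos j = (s.loc j).pos j) :
    ((s.loc p).done : Set ℕ) = s.recorded := by
  ext z
  simp only [mem_coe, hs.log.mem_known, State.recorded, Set.mem_ofPred_eq]
  constructor
  · rintro ⟨q, i, h1, hi, rfl⟩
    exact ⟨(hs.log.cell_pos_iff q i).2 ⟨h1, hpos q ▸ hi⟩, q, i, rfl⟩
  · rintro ⟨hz, q, i, rfl⟩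
    obtain ⟨h1, hi⟩ := (hs.log.cell_pos_iff q i).1 hz
    exact ⟨q, i, h1, (hpos q).symm ▸ hi, rfl⟩

theorem finalTry_gatherTry (hs : Inv n β s) (hst : (s.loc p).status = .gatherTry) :
    (s.setLoc p ((s.loc p).gatherTry n s.next p)).finalTry p = s.finalTry p := by
  have hvisited : ((s.loc p).gatherTry n s.next p).visited .gatherTry = Iic (s.loc p).q := by
    rw [LocalState.gatherTry_eq, ← hst]
    exact LocalState.visited_advance (by simp [hst, Status.phase])
  ext z
  simp only [State.finalTry, State.setLoc_loc_self, State.setLoc_next, hvisited,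
    LocalState.visited_of_status_eq hst, Set.mem_union, mem_coe, Set.mem_image, Set.mem_ofPred_eq,
    LocalState.mem_gatherTry_try _ hs.next_le, mem_Iic, mem_Iio, le_iff_lt_or_eq]
  grind

end Inv

/-- Process `p` is in one of the gathering loops or has just left them, and it has read all the
entries in the rows of the matrix `done` that it has handled. -/
structure Gathering (n β : ℕ) (p : Fin m) (s : State m) : Prop where
  inv : Inv n β s
  status_mem : (s.loc p).status ∈ ({.gatherTry, .gatherDone, .check} : Set Status)
  pos_eq : ∀ j ∈ (s.loc p).visited .gatherDone, (s.loc p).pos j = (s.loc j).pos j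

namespace Gathering

variable {s : State m} {p : Fin m}

theorem gatherTry (h : Gathering n β p s) (hst : (s.loc p).status = .gatherTry) :
    Gathering n β p (s.setLoc p ((s.loc p).gatherTry n s.next p)) where
  inv := h.inv.setLoc ((h.inv.loc p).gatherTry hst _) (by simp [LocalState.gatherTry_eq])
      (by simp [LocalState.gatherTry_eq])
  status_mem := by
    rw [State.setLoc_loc_self, LocalState.gatherTry_eq]
    rcases (s.loc p).advance_status_eq_or .gatherDone with hst' | hst' <;> simp [hst', hst]
  pos_eq := by
    have hvisited : ((s.loc p).gatherTry n s.next p).visited .gatherDone = ∅ := by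
      rw [LocalState.gatherTry_eq]
      exact LocalState.visited_advance_self (by simp [hst, Status.phase])
    simp [hvisited]

theorem advance (h : Gathering n β p s) (hst : (s.loc p).status = .gatherDone)
    (hread : ¬ ((s.loc p).q ≠ p ∧ (s.loc p).pos (s.loc p).q ≤ n ∧
      0 < s.done (s.loc p).q ((s.loc p).pos (s.loc p).q))) :
    Gathering n β p (s.setLoc p ((s.loc p).advance .check)) where
  inv := by
    have hinv := h.inv.gatherDone hst
    rwa [LocalState.gatherDone, if_neg hread] at hinv
  status_mem := by
    rw [State.setLoc_loc_self]
    rcases (s.loc p).advance_status_eq_or .check with hst' | hst' <;> simp [hst', hst]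
  pos_eq j hj := by
    rcases eq_or_ne j p with rfl | hjp
    · rfl
    rw [State.setLoc_loc_self, ← hst, LocalState.visited_advance (by simp [hst, Status.phase]),
      mem_Iic] at hj
    rw [State.setLoc_loc_self, State.setLoc_loc_of_ne _ hjp, LocalState.advance_pos]
    rcases hj.lt_or_eq with hlt | rfl
    · exact h.pos_eq j (by rwa [LocalState.visited_of_status_eq hst, mem_Iio])
    · exact h.inv.pos_eq_of_not_read hjp hread

theorem read (h : Gathering n β p s) (hst : (s.loc p).status = .gatherDone)
    (hread : (s.loc p).q ≠ p ∧ (s.loc p).pos (s.loc p).q ≤ n ∧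
      0 < s.done (s.loc p).q ((s.loc p).pos (s.loc p).q)) :
    Gathering n β p (s.setLoc p ((s.loc p).gatherDone n s.done p)) where
  inv := h.inv.gatherDone hst
  status_mem := by
    rw [State.setLoc_loc_self, LocalState.gatherDone, if_pos hread]
    exact h.status_mem
  pos_eq j hj := by
    rcases eq_or_ne j p with rfl | hjp
    · rfl
    rw [State.setLoc_loc_self, LocalState.gatherDone, if_pos hread] at hj
    rw [State.setLoc_loc_self, State.setLoc_loc_of_ne _ hjp, LocalState.gatherDone, if_pos hread]
    have hlt : j < (s.loc p).q := by
      rwa [LocalState.visited_of_status_eq (by simpa using hst), mem_Iio] at hj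
    simpa [hlt.ne] using h.pos_eq j hj

end Gathering

/-- A bound on the number of steps that a gathering process needs to reach `check` alone. -/
def LocalState.gatherCost (n : ℕ) (l : LocalState m) : ℕ :=
  l.stepsLeft + ∑ j, (n + 1 - l.pos j)

theorem LocalState.gatherCost_gatherDone_lt {l : LocalState m} {p : Fin m}
    {done : Fin m → ℕ → ℕ} (hread : l.q ≠ p ∧ l.pos l.q ≤ n ∧ 0 < done l.q (l.pos l.q)) :
    (l.gatherDone n done p).gatherCost n < l.gatherCost n := by
  rw [LocalState.gatherDone, if_pos hread]
  refine Nat.add_lt_add_left (sum_lt_sum (fun j _ => ?_) ⟨l.q, mem_univ _, ?_⟩) _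
  · rcases eq_or_ne j l.q with rfl | hj
    · simp only [Function.update_self]
      omega
    · simp [hj]
  · simp only [Function.update_self]
    omega

theorem QuietStep.gatherCost_lt {s : State m} {p : Fin m} {l : LocalState m} {x : ℕ}
    (h : QuietStep n β p s l x) (hst : (s.loc p).status ≠ .compNext) :
    l.gatherCost n < (s.loc p).gatherCost n := by
  rw [LocalState.gatherCost, h.pos_eq]
  exact Nat.add_lt_add_right (h.stepsLeft_lt hst) _

theorem Gathering.exists_step {s : State m} {p : Fin m} (h : Gathering n β p s)
    (hst : (s.loc p).status ≠ .check) :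
    ∃ l, Reach n β J C s (s.setLoc p l) ∧ Gathering n β p (s.setLoc p l) ∧
      l.nxt = (s.loc p).nxt ∧ (s.setLoc p l).finalTry p = s.finalTry p ∧
      l.gatherCost n < (s.loc p).gatherCost n := by
  have htry (hst : (s.loc p).status = .gatherDone) {l : LocalState m}
      (hl : l.status = .gatherDone ∨ l.status = .check) (ht : l.try_ = (s.loc p).try_) :
      (s.setLoc p l).finalTry p = s.finalTry p := by
    rw [State.finalTry_of_phase_lt
      (by rw [State.setLoc_loc_self]; rcases hl with hl | hl <;> simp [hl, Status.phase]),
      State.finalTry_of_phase_lt (by simp [hst, Status.phase]), State.setLoc_loc_self, ht]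
  rcases h.status_mem with hst' | hst' | hst'
  · exact ⟨_, .single (.gatherTry p) ⟨hst', rfl⟩, h.gatherTry hst',
      by simp [LocalState.gatherTry_eq], h.inv.finalTry_gatherTry hst',
      (QuietStep.gatherTry (β := β) hst').gatherCost_lt (by simp [hst'])⟩
  · by_cases hread : (s.loc p).q ≠ p ∧ (s.loc p).pos (s.loc p).q ≤ n ∧
        0 < s.done (s.loc p).q ((s.loc p).pos (s.loc p).q)
    · exact ⟨_, .single (.gatherDone p) ⟨hst', rfl⟩, h.read hst' hread,
        by rw [LocalState.gatherDone, if_pos hread],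
        htry hst' (by rw [LocalState.gatherDone, if_pos hread]; exact Or.inl hst')
          (by rw [LocalState.gatherDone, if_pos hread]),
        LocalState.gatherCost_gatherDone_lt hread⟩
    · exact ⟨_, .single (.gatherDone p) ⟨hst', by rw [LocalState.gatherDone, if_neg hread]⟩,
        h.advance hst' hread, by simp,
        htry hst' (hst' ▸ (s.loc p).advance_status_eq_or .check) (by simp),
        (QuietStep.gatherDone (β := β) hst' hread).gatherCost_lt (by simp [hst'])⟩
  · exact absurd hst' hst

theorem Gathering.reach_check {s : State m} {p : Fin m} (h : Gathering n β p s) :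
    ∃ l, Reach n β J C s (s.setLoc p l) ∧ Gathering n β p (s.setLoc p l) ∧ l.status = .check ∧
      l.nxt = (s.loc p).nxt ∧ l.try_ = s.finalTry p := by
  induction hd : (s.loc p).gatherCost n using Nat.strong_induction_on generalizing s with
  | _ d ih =>
    by_cases hst : (s.loc p).status = .check
    · exact ⟨s.loc p, by simpa only [State.setLoc_loc] using Reach.refl s,
        by simpa only [State.setLoc_loc] using h, hst, rfl,
        (State.finalTry_of_phase_lt (by simp [hst, Status.phase])).symm⟩
    · obtain ⟨l, hreach, hl, hnxt, htry, hlt⟩ := h.exists_step (J := J) (C := C) hst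
      obtain ⟨l', hreach', hl', hst', hnxt', htry'⟩ :=
        ih _ (hd ▸ by rwa [State.setLoc_loc_self]) hl rfl
      rw [State.setLoc_setLoc] at hreach' hl'
      rw [State.setLoc_loc_self] at hnxt'
      exact ⟨l', hreach.trans hreach', hl', hst', hnxt'.trans hnxt, htry'.trans htry⟩

theorem Gathering.pos_eq_of_check {s : State m} {p : Fin m} (h : Gathering n β p s)
    (hst : (s.loc p).status = .check) (j : Fin m) : (s.loc p).pos j = (s.loc j).pos j :=
  h.pos_eq j (by
    rw [LocalState.visited_of_phase_lt (by simp [hst, Status.phase])]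
    exact mem_univ j)

theorem Inv.gathering {s : State m} {p : Fin m} (hs : Inv n β s)
    (hst : (s.loc p).status = .gatherTry) : Gathering n β p s :=
  ⟨hs, by simp [hst], fun j hj => by
    rw [LocalState.visited_of_phase_gt (by simp [hst, Status.phase])] at hj
    exact absurd hj (notMem_empty j)⟩

theorem Inv.reach_of_mem_finalTry {s : State m} {p : Fin m} (hs : Inv n β s)
    (hst : (s.loc p).status = .gatherTry) (hconflict : (s.loc p).nxt ∈ s.finalTry p) :
    ∃ l, Reach n β J C s (s.setLoc p l) ∧ l.status = .compNext ∧ l.try_ = s.finalTry p ∧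
      (l.done : Set ℕ) = s.recorded := by
  obtain ⟨l, hreach, hl, hst, hnxt, htry⟩ := (hs.gathering hst).reach_check (J := J) (C := C)
  have hmem : l.nxt ∈ l.try_ := by rwa [← mem_coe, htry, hnxt]
  have hdone := hl.inv.coe_done_eq_recorded (hl.pos_eq_of_check (by simpa using hst))
  exact ⟨{ l with status := .compNext },
    hreach.trans (.single (.check p) ⟨by simpa using hst, by simp [LocalState.check, hmem]⟩), rfl,
    htry, by simpa using hdone⟩

theorem Inv.reach_of_notMem_finalTry {s : State m} {p : Fin m} (hβ : m ≤ β) (hs : Inv n β s)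
    (hst : (s.loc p).status = .gatherTry) (htry : (s.loc p).nxt ∉ s.finalTry p)
    (hrec : (s.loc p).nxt ∉ s.recorded) (hJ : (s.loc p).nxt ∈ J) :
    ∃ s', Reach n β J C s s' ∧ (∀ q ≠ p, s'.loc q = s.loc q) ∧ s'.next = s.next ∧
      (s'.loc p).status = .compNext ∧ (s'.loc p).try_ = s.finalTry p ∧
      s'.recorded = insert (s.loc p).nxt s.recorded ∧ ((s'.loc p).done : Set ℕ) = s'.recorded := by
  obtain ⟨l, hreach, hl, hst, hnxt, htry'⟩ := (hs.gathering hst).reach_check (J := J) (C := C)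
  have hpos := hl.pos_eq_of_check (by simpa using hst)
  have hdone : (l.done : Set ℕ) = s.recorded := by simpa using hl.inv.coe_done_eq_recorded hpos
  rw [← hnxt] at htry hrec hJ
  rw [← htry', mem_coe] at htry
  rw [← hdone, mem_coe] at hrec
  set t := s.setLoc p { l with status := .record } with ht
  have htp : t.loc p = { l with status := .record } := State.setLoc_loc_self _ _ _
  set s' : State m := { t.setLoc p ((t.loc p).record p) with
    done := Function.update t.done p
      (Function.update (t.done p) ((t.loc p).pos p) (t.loc p).nxt) } with hs'
  have hreach' : Reach n β J C s s' :=
    ((hreach.trans (.single (.check p) ⟨by simpa using hst, rfl⟩)).trans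
      (.single (.perform p l.nxt) ⟨by simp [LocalState.check, htry, hrec],
        by simp [LocalState.check, htry, hrec], rfl⟩ hJ)).trans
      (.single (.record p) ⟨by simp, by simp [LocalState.check, htry, hrec, hs', ht]⟩)
  have hloc : s'.loc p = LocalState.record p { l with status := .record } := by
    rw [← htp]
    exact State.setLoc_loc_self _ _ _
  have hloc' (q : Fin m) (hq : q ≠ p) : s'.loc q = s.loc q := by
    rw [← State.setLoc_loc_of_ne s hq _, ← State.setLoc_loc_of_ne t hq]
  have hdone' : ((s'.loc p).done : Set ℕ) = s'.recorded := by
    refine (hreach'.inv hβ hs).coe_done_eq_recorded fun j => ?_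
    rcases eq_or_ne j p with rfl | hj
    · rfl
    · simpa [hloc, hloc' j hj, LocalState.record, hj] using hpos j
  refine ⟨s', hreach', hloc', rfl, by rw [hloc]; rfl, by rw [hloc]; exact htry', ?_, hdone'⟩
  rw [← hdone', ← hdone, hloc, ← hnxt]
  exact coe_insert _ _

theorem LocalInv.try_eq_empty {p : Fin m} {l : LocalState m} (hl : LocalInv n β p l)
    (hst : l.status = .setNext) : l.try_ = ∅ := by
  have h := hl.card_try_le
  rw [LocalState.visited_of_phase_gt (by simp [hst, Status.phase])] at h
  simpa using h

/-- Let the processes in `A` run one after the other. -/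
theorem Reach.forall_mem {R : State m → Prop} {Good : Fin m → LocalState m → ℕ → Prop}
    (A : Finset (Fin m)) {s₀ : State m} (hR : R s₀)
    (hone : ∀ q ∈ A, ∀ s, R s → s.loc q = s₀.loc q → s.next q = s₀.next q →
      ∃ s', Reach n β J C s s' ∧ R s' ∧
        (∀ j ≠ q, s'.loc j = s.loc j ∧ s'.next j = s.next j) ∧ Good q (s'.loc q) (s'.next q)) :
    ∃ s, Reach n β J C s₀ s ∧ R s ∧ (∀ q ∈ A, Good q (s.loc q) (s.next q)) ∧
      ∀ q ∉ A, s.loc q = s₀.loc q ∧ s.next q = s₀.next q := by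
  induction A using Finset.induction_on with
  | empty => exact ⟨s₀, .refl _, hR, by simp, by simp⟩
  | insert a A ha ih =>
    obtain ⟨s, hreach, hRs, hgood, hsame⟩ := ih fun q hq => hone q (mem_insert_of_mem hq)
    obtain ⟨s', hreach', hRs', hsame', hgood'⟩ :=
      hone a (mem_insert_self _ _) s hRs (hsame a ha).1 (hsame a ha).2
    refine ⟨s', hreach.trans hreach', hRs', fun q hq => ?_, fun q hq => ?_⟩
    · rcases mem_insert.1 hq with rfl | hqA
      · exact hgood'
      · have hqa : q ≠ a := ne_of_mem_of_not_mem hqA ha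
        rw [(hsame' q hqa).1, (hsame' q hqa).2]
        exact hgood q hqA
    · rw [mem_insert, not_or] at hq
      rw [(hsame' q hq.1).1, (hsame' q hq.1).2]
      exact hsame q hq.2

theorem elementOfRank_one {S : Finset ℕ} {x : ℕ} (h : IsLeast (S : Set ℕ) x) :
    elementOfRank S 1 = x := by
  have hcount : Nat.count (· ∈ S) x = 0 := by
    rw [Nat.count_eq_card_filter_range, card_eq_zero, filter_eq_empty_iff]
    exact fun z hz hzS => (mem_range.1 hz).not_ge (h.2 hzS)
  simpa only [hcount] using elementOfRank_count_add_one (mem_coe.1 h.1)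

theorem elementOfRank_Icc {r : ℕ} (h1 : 1 ≤ r) (hn : r ≤ n) : elementOfRank (Icc 1 n) r = r := by
  have hcount : Nat.count (· ∈ Icc 1 n) r + 1 = r := by
    have hfilter : {z ∈ range r | z ∈ Icc 1 n} = Ico 1 r := by
      ext z
      simp only [mem_filter, mem_range, mem_Icc, mem_Ico]
      omega
    rw [Nat.count_eq_card_filter_range, hfilter, Nat.card_Ico]
    omega
  simpa only [hcount] using elementOfRank_count_add_one (mem_Icc.2 ⟨h1, hn⟩)

/-! ### The schedule of the adversary -/

/-- The local state `l` of a process `q` that does not work, and the content `v` of its cell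
`next`, when the working process has dealt with all jobs below `y`. Such a process selects a job
`j` at the very beginning. The processes in `C` announce their job and crash; any other process
waits until the worker has announced `j`, then announces `j` as well, reads the worker's cell
`next`, and pauses. -/
inductive Bystander (C : Finset (Fin m)) (y : ℕ) (q : Fin m) (j : ℕ) : LocalState m → ℕ → Prop
  | crashed {l : LocalState m} (hq : q ∈ C) (hst : l.status = .stopped) : Bystander C y q j l j
  | waiting {l : LocalState m} (hq : q ∉ C) (hy : y ≤ j) (hst : l.status = .setNext)
      (hnxt : l.nxt = j) : Bystander C y q j l 0
  | paused {l : LocalState m} (hq : q ∉ C) (hy : j < y) (hst : l.status = .gatherTry)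
      (hloop : l.q.val = 1) (htry : l.try_ = {j}) (hnxt : l.nxt = j) : Bystander C y q j l j

namespace Bystander

variable {q : Fin m} {y j v : ℕ} {l : LocalState m}

theorem succ (h : Bystander C y q j l v) (hj : q ∉ C → j ≠ y) : Bystander C (y + 1) q j l v := by
  cases h with
  | crashed hq hst => exact .crashed hq hst
  | waiting hq hy hst hnxt => exact .waiting hq (hy.lt_of_ne' (hj hq)) hst hnxt
  | paused hq hy hst hloop htry hnxt =>
    exact .paused hq (hy.trans (lt_add_one y)) hst hloop htry hnxt

theorem eq_ite (h : Bystander C y q j l v) : v = if j < y ∨ q ∈ C then j else 0 := by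
  cases h with
  | crashed hq => rw [if_pos (Or.inr hq)]
  | waiting hq hy => rw [if_neg (not_or_intro hy.not_gt hq)]
  | paused _ hy => rw [if_pos (Or.inl hy)]

theorem waiting_of_le (h : Bystander C y q j l v) (hq : q ∉ C) (hy : y ≤ j) :
    l.status = .setNext ∧ l.nxt = j := by
  cases h with
  | crashed hq' => exact absurd hq' hq
  | waiting _ _ hst hnxt => exact ⟨hst, hnxt⟩
  | paused _ hy' => exact absurd hy hy'.not_ge

end Bystander

/-- The jobs below `y` that the worker `w` performs when every other process `q` announces the
job `x q` in time. -/
def performed (x : Fin m → ℕ) (w : Fin m) (y : ℕ) : Finset ℕ :=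
  Ico 1 y \ (univ.erase w).image x

/-- The jobs from `y` on that are not announced by a crashed process. -/
def remaining (n : ℕ) (C : Finset (Fin m)) (x : Fin m → ℕ) (y : ℕ) : Finset ℕ :=
  Icc y n \ C.image x

section Jobs

variable {x : Fin m → ℕ} {w : Fin m} {y : ℕ}

theorem performed_succ_of_mem (hy : y ∈ (univ.erase w).image x) :
    performed x w (y + 1) = performed x w y := by
  ext z
  simp only [performed, Finset.mem_sdiff, mem_Ico, Nat.lt_succ_iff_lt_or_eq]
  grind

theorem performed_succ_of_notMem (hy1 : 1 ≤ y) (hy : y ∉ (univ.erase w).image x) :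
    performed x w (y + 1) = insert y (performed x w y) := by
  ext z
  simp only [performed, Finset.mem_sdiff, mem_Ico, mem_insert, Nat.lt_succ_iff_lt_or_eq]
  grind

theorem self_mem_remaining : y ∈ remaining n C x y ↔ y ≤ n ∧ y ∉ C.image x := by
  simp only [remaining, Finset.mem_sdiff, mem_Icc, le_refl, true_and]

theorem notMem_performed : y ∉ performed x w y := by
  simp [performed]

theorem sdiff_subset_remaining {T : Finset ℕ} (hwC : w ∉ C) (hT : ∀ q ≠ w, x q ∈ T) :
    (Icc 1 n \ performed x w y) \ T ⊆ remaining n C x y := by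
  intro z hz
  simp only [performed, remaining, Finset.mem_sdiff, mem_Icc, mem_Ico, mem_image, mem_erase,
    mem_univ, and_true, not_exists, not_and] at hz ⊢
  obtain ⟨⟨⟨h1, hn⟩, hperformed⟩, hzT⟩ := hz
  have hne (q : Fin m) (hq : q ≠ w) : x q ≠ z := fun h => hzT (h ▸ hT q hq)
  refine ⟨⟨?_, hn⟩, fun q hq => hne q (ne_of_mem_of_not_mem hq hwC)⟩
  by_contra! hlt
  exact hperformed ⟨h1, hlt⟩ hne

end Jobs

theorem Inv.reach_pause {s : State m} {w r : Fin m} (hβ : m ≤ β) (hs : Inv n β s)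
    (hw : w.val = 0) (hrw : r ≠ w) (hst : (s.loc r).status = .setNext)
    (hnext : s.next w = (s.loc r).nxt) :
    ∃ l, Reach n β J C s ((s.announce r).setLoc r l) ∧ l.status = .gatherTry ∧ l.q.val = 1 ∧
      l.try_ = {(s.loc r).nxt} ∧ l.nxt = (s.loc r).nxt := by
  set t := s.announce r with ht
  have hreach : Reach n β J C s t := .announce hst
  have hq : (t.loc r).q = w := by
    rw [ht, State.announce_loc_self]
    exact Fin.ext (((hs.loc r).q_eq_zero hst).trans hw.symm)
  have htry : (t.loc r).try_ = ∅ := by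
    rw [ht, State.announce_loc_self]
    exact (hs.loc r).try_eq_empty hst
  have htst : (t.loc r).status = .gatherTry := by simp [ht]
  have hrm : 1 < m := by
    have hr0 : r.val ≠ w.val := Fin.val_ne_of_ne hrw
    omega
  refine ⟨_, hreach.trans (.single (.gatherTry r) ⟨htst, rfl⟩), ?_⟩
  rcases (t.loc r).advance_spec .gatherDone with ⟨-, hst', hq'⟩ | ⟨hlast, -⟩
  · refine ⟨by simp [LocalState.gatherTry_eq, hst', htst], ?_, ?_, ?_⟩
    · rw [LocalState.gatherTry_eq, hq', hq, hw]
    · ext z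
      rw [LocalState.mem_gatherTry_try _ (hreach.inv hβ hs).next_le, htry, hq, ht,
        State.announce_next_of_ne _ hrw.symm, hnext]
      simp [hrw.symm]
    · simp [LocalState.gatherTry_eq, ht]
  · rw [hq, hw] at hlast
    omega

/-- The worker `w` has dealt with all jobs below `y`: it has performed those that no other process
has selected, and given up each of the others after reading it in the array `next`. -/
structure Stage (n β : ℕ) (C : Finset (Fin m)) (x : Fin m → ℕ) (w : Fin m) (y : ℕ)
    (s : State m) : Prop where
  inv : Inv n β s
  status_eq : (s.loc w).status = .compNext
  bystander : ∀ q ≠ w, Bystander C y q (x q) (s.loc q) (s.next q)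
  done_eq : ((s.loc w).done : Set ℕ) = s.recorded
  recorded_eq : s.recorded = performed x w y
  try_subset : ((s.loc w).try_ : Set ℕ) ⊆ s.next '' {w}ᶜ
  subset_try : 1 < y → s.next '' {w}ᶜ ⊆ (s.loc w).try_

theorem exists_bystander (hβ : m ≤ β) (hn : β ≤ n) {s : State m} {q : Fin m}
    (hloc : s.loc q = (initState n m).loc q) (hnext : s.next q = (initState n m).next q) :
    ∃ s', Reach n β J C s s' ∧ s'.recorded = s.recorded ∧
      (∀ j ≠ q, s'.loc j = s.loc j ∧ s'.next j = s.next j) ∧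
      Bystander C 1 q (chosenRank m n q) (s'.loc q) (s'.next q) := by
  have hrank : 1 ≤ chosenRank m n q := one_le_chosenRank m n q
  have hrank' : chosenRank m n q ≤ n := chosenRank_le q.2 (hβ.trans hn) (by omega)
  set l := (s.loc q).compNext β q with hl
  have hselect : Reach n β J C s (s.setLoc q l) := .single (.compNext q) ⟨by rw [hloc]; rfl, rfl⟩
  have hlst : l.status = .setNext ∧ l.nxt = chosenRank m n q := by
    rw [hl, hloc, LocalState.compNext_of_le (by simpa [initState] using hn)]
    simp [initState, elementOfRank_Icc hrank hrank']
  by_cases hq : q ∈ C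
  · set t := (s.setLoc q l).announce q
    refine ⟨t.setLoc q { t.loc q with status := .stopped }, (hselect.trans (.announce
      (by simpa using hlst.1))).trans (.single (.crash q) ⟨by simp, rfl⟩ hq), rfl,
      fun j hj => by simp [t, hj], ?_⟩
    rw [State.setLoc_next, State.announce_next_self, State.setLoc_loc_self, State.setLoc_loc_self,
      hlst.2]
    exact .crashed hq rfl
  · refine ⟨_, hselect, rfl, fun j hj => by simp [hj], ?_⟩
    rw [State.setLoc_next, State.setLoc_loc_self, hnext]
    exact .waiting hq hrank hlst.1 hlst.2

theorem exists_stage_one (hβ : m ≤ β) (hn : β ≤ n) (w : Fin m) :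
    ∃ s, Reach n β J C (initState n m) s ∧ Stage n β C (fun q => chosenRank m n q) w 1 s := by
  have hrec₀ : (initState n m).recorded = ∅ := by
    ext z
    simp only [State.recorded, initState, Set.mem_ofPred_eq, Set.mem_empty_iff_false]
    grind
  obtain ⟨s, hreach, hrec, hbystander, hsame⟩ := Reach.forall_mem (n := n) (β := β) (J := J)
    (C := C) (R := fun s => s.recorded = ∅)
    (Good := fun q => Bystander C 1 q (chosenRank m n q)) (univ.erase w) hrec₀ (by
      intro q _ s hrec hloc hnext
      obtain ⟨s', hreach, hrec', hsame, hq⟩ := exists_bystander hβ hn hloc hnext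
      exact ⟨s', hreach, hrec'.trans hrec, hsame, hq⟩)
  have hw : s.loc w = (initState n m).loc w := (hsame w (by simp)).1
  exact ⟨s, hreach, {
    inv := hreach.inv hβ (inv_initState n m β)
    status_eq := by rw [hw]; rfl
    bystander := fun q hq => hbystander q (by simpa using hq)
    done_eq := by rw [hw, hrec]; exact coe_empty
    recorded_eq := by simp [hrec, performed]
    try_subset := by rw [hw]; simp [initState]
    subset_try := fun h => absurd h (lt_irrefl 1) }⟩

namespace Stage

variable {x : Fin m → ℕ} {w : Fin m} {y : ℕ} {s : State m}

theorem next_eq (h : Stage n β C x w y s) {q : Fin m} (hq : q ≠ w) :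
    s.next q = if x q < y ∨ q ∈ C then x q else 0 :=
  (h.bystander q hq).eq_ite

theorem free_eq (h : Stage n β C x w y s) : (s.loc w).free = Icc 1 n \ performed x w y := by
  have hdone : (s.loc w).done = performed x w y := coe_injective (h.done_eq.trans h.recorded_eq)
  rw [(h.inv.loc w).free_eq, hdone]

theorem remaining_subset (h : Stage n β C x w y s) (hy : 1 ≤ y) :
    remaining n C x y ⊆ (s.loc w).free \ (s.loc w).try_ := by
  intro z hz
  simp only [remaining, Finset.mem_sdiff, mem_Icc, mem_image, not_exists, not_and] at hz
  obtain ⟨⟨hyz, hzn⟩, hzC⟩ := hz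
  rw [Finset.mem_sdiff, h.free_eq, Finset.mem_sdiff, mem_Icc]
  refine ⟨⟨⟨by omega, hzn⟩, fun hz => ?_⟩, fun hz => ?_⟩
  · simp only [performed, Finset.mem_sdiff, mem_Ico] at hz
    omega
  · obtain ⟨q, hq, rfl⟩ := h.try_subset hz
    rw [h.next_eq hq] at hyz hzC
    split_ifs at hyz hzC with hif
    · exact hif.elim (fun hlt => hlt.not_ge hyz) fun hqC => hzC q hqC rfl
    · omega

theorem le_of_mem_sdiff (h : Stage n β C x w y s) {z : ℕ}
    (hz : z ∈ (s.loc w).free \ (s.loc w).try_) : y ≤ z := by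
  rw [Finset.mem_sdiff, h.free_eq, Finset.mem_sdiff, mem_Icc] at hz
  obtain ⟨⟨⟨h1, -⟩, hperformed⟩, htry⟩ := hz
  by_contra! hlt
  have hmem : z ∈ (univ.erase w).image x := by
    by_contra hz
    exact hperformed (Finset.mem_sdiff.2 ⟨mem_Ico.2 ⟨h1, hlt⟩, hz⟩)
  obtain ⟨q, hq, rfl⟩ := mem_image.1 hmem
  have hqw : q ≠ w := ne_of_mem_erase hq
  refine htry (h.subset_try (by omega) ⟨q, hqw, ?_⟩)
  rw [h.next_eq hqw, if_pos (Or.inl hlt)]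

theorem reach_announce (h : Stage n β C x w y s) (hw : w.val = 0) (hy : 1 ≤ y)
    (hmem : y ∈ remaining n C x y) (hcard : β ≤ #(remaining n C x y)) :
    ∃ l, Reach n β J C s ((s.setLoc w l).announce w) ∧ l.nxt = y ∧ l.q.val = 0 ∧ l.try_ = ∅ := by
  have hsub := h.remaining_subset hy
  have hnxt : elementOfRank ((s.loc w).free \ (s.loc w).try_)
      (chosenRank m #(s.loc w).free w) = y := by
    rw [hw, chosenRank_zero]
    exact elementOfRank_one ⟨hsub hmem, fun z hz => h.le_of_mem_sdiff hz⟩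
  have hcompNext := LocalState.compNext_of_le (p := w) (hcard.trans (card_le_card hsub))
  rw [hnxt] at hcompNext
  exact ⟨_, (Reach.single (.compNext w) ⟨h.status_eq, rfl⟩).trans
    (.announce (by simp [hcompNext])), by simp [hcompNext], by simp [hcompNext],
    by simp [hcompNext]⟩

theorem skip (h : Stage n β C x w y s) (hx : Function.Injective x) (hy : 1 < y) {q : Fin m}
    (hqw : q ≠ w) (hqC : q ∈ C) (hyq : x q = y) : Stage n β C x w (y + 1) s where
  inv := h.inv
  status_eq := h.status_eq
  bystander j hj := (h.bystander j hj).succ fun hjC hjy =>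
    hjC (hx (hjy.trans hyq.symm) ▸ hqC)
  done_eq := h.done_eq
  recorded_eq := by
    rw [h.recorded_eq, performed_succ_of_mem (mem_image.2 ⟨q, by simpa using hqw, hyq⟩)]
  try_subset := h.try_subset
  subset_try _ := h.subset_try hy

theorem perform (h : Stage n β C x w y s) (hβ : m ≤ β) (hw : w.val = 0) (hwC : w ∉ C)
    (hyn : y ∈ Icc 1 n) (hyx : y ∉ (univ.erase w).image x)
    (hcard : β ≤ #(remaining n C x y)) (hJ : y ∈ J) :
    ∃ s', Reach n β J C s s' ∧ Stage n β C x w (y + 1) s' := by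
  obtain ⟨hy1, hyn⟩ := mem_Icc.1 hyn
  have hne (q : Fin m) (hq : q ≠ w) : x q ≠ y := fun hqy =>
    hyx (mem_image.2 ⟨q, by simpa using hq, hqy⟩)
  have hmem : y ∈ remaining n C x y := self_mem_remaining.2 ⟨hyn, fun hyC =>
    hyx (image_subset_image (fun q hq => by simpa using ne_of_mem_of_not_mem hq hwC) hyC)⟩
  obtain ⟨l, hreach, hnxt, hq, htry⟩ := h.reach_announce (J := J) hw hy1 hmem hcard
  set t := (s.setLoc w l).announce w with ht
  have hnext (q : Fin m) (hq : q ≠ w) : t.next q = s.next q := by simp [ht, hq]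
  have hfinal : t.finalTry w = t.next '' {w}ᶜ :=
    State.finalTry_eq_image (by simp [ht]) (by simpa [ht] using hq) (by simpa [ht] using htry)
  have hnxt : (t.loc w).nxt = y := by simpa [ht] using hnxt
  obtain ⟨s', hreach', hloc, hnext', hst, htry', hrec, hdone⟩ :=
    (hreach.inv hβ h.inv).reach_of_notMem_finalTry (J := J) (C := C) (p := w) hβ (by simp [ht])
      (by
        rw [hnxt, hfinal]
        rintro ⟨q, hq, hqy⟩
        rw [hnext q hq, h.next_eq hq] at hqy
        split_ifs at hqy
        · exact hne q hq hqy
        · omega)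
      (by
        rw [hnxt, ht, State.announce_recorded, State.setLoc_recorded, h.recorded_eq]
        exact notMem_performed)
      (hnxt.symm ▸ hJ)
  refine ⟨s', hreach.trans hreach', (hreach.trans hreach').inv hβ h.inv, hst, fun q hq => ?_,
    hdone, ?_, ?_, fun _ => ?_⟩
  · rw [hloc q hq, hnext', hnext q hq, ht, State.announce_loc_of_ne _ hq,
      State.setLoc_loc_of_ne _ hq]
    exact (h.bystander q hq).succ fun _ => hne q hq
  · rw [hrec, hnxt, ht, State.announce_recorded, State.setLoc_recorded, h.recorded_eq,
      performed_succ_of_notMem hy1 hyx, coe_insert]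
  · rw [htry', hfinal, hnext']
  · rw [htry', hfinal, hnext']

theorem collide {r : Fin m} (h : Stage n β C x w (x r) s) (hx : Function.Injective x)
    (hβ : m ≤ β) (hw : w.val = 0) (hrw : r ≠ w) (hrC : r ∉ C) (hrn : x r ∈ Icc 1 n)
    (hcard : β ≤ #(remaining n C x (x r))) :
    ∃ s', Reach n β J C s s' ∧ Stage n β C x w (x r + 1) s' := by
  obtain ⟨h1, hn⟩ := mem_Icc.1 hrn
  have hmem : x r ∈ remaining n C x (x r) :=
    self_mem_remaining.2 ⟨hn, fun hr => hrC (hx.mem_finset_image.1 hr)⟩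
  obtain ⟨l, hreach, hnxt, hq, htry⟩ := h.reach_announce (J := J) hw h1 hmem hcard
  set t := (s.setLoc w l).announce w with ht
  have hloc (q : Fin m) (hq : q ≠ w) : t.loc q = s.loc q := by simp [ht, hq]
  obtain ⟨hrst, hrnxt⟩ := (h.bystander r hrw).waiting_of_le hrC le_rfl
  rw [← hloc r hrw] at hrst hrnxt
  obtain ⟨l', hpause, hst', hq', htry', hnxt'⟩ := (hreach.inv hβ h.inv).reach_pause (J := J)
    (C := C) hβ hw hrw hrst (by rw [hrnxt, ht, State.announce_next_self]; simpa using hnxt)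
  rw [hrnxt] at htry' hnxt'
  set u := (t.announce r).setLoc r l' with hu
  have hlocw : u.loc w = { l with status := .gatherTry } := by simp [hu, ht, hrw.symm]
  have hnextr : u.next r = x r := by simp [hu, hrnxt]
  have hfinal : u.finalTry w = u.next '' {w}ᶜ :=
    State.finalTry_eq_image (by rw [hlocw]) (by rw [hlocw, hq]) (by rw [hlocw, htry])
  have hreachu := hreach.trans hpause
  obtain ⟨l'', hreach', hst'', htry'', hdone⟩ :=
    (hreachu.inv hβ h.inv).reach_of_mem_finalTry (J := J) (C := C) (p := w) (by rw [hlocw])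
      (by rw [hfinal, hlocw, hnxt]; exact ⟨r, hrw, hnextr⟩)
  have htry'' : (l''.try_ : Set ℕ) = u.next '' {w}ᶜ := htry''.trans hfinal
  refine ⟨u.setLoc w l'', hreachu.trans hreach', (hreachu.trans hreach').inv hβ h.inv, by simpa,
    fun q hq => ?_, by simpa using hdone, ?_, by simp [htry''], fun _ => by simp [htry'']⟩
  · rw [State.setLoc_loc_of_ne _ hq, State.setLoc_next]
    rcases eq_or_ne q r with rfl | hqr
    · rw [hnextr, hu, State.setLoc_loc_self]
      exact .paused hrC (lt_add_one _) hst' hq' htry' hnxt'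
    · have hlocq : u.loc q = s.loc q := by simp [hu, ht, hq, hqr]
      have hnextq : u.next q = s.next q := by simp [hu, ht, hq, hqr]
      rw [hlocq, hnextq]
      exact (h.bystander q hq).succ fun _ => hx.ne hqr
  · rw [performed_succ_of_mem (mem_image.2 ⟨r, by simpa using hrw, rfl⟩), ← h.recorded_eq]
    rfl

theorem exists_succ (h : Stage n β C x w y s) (hx : Function.Injective x) (hβ : m ≤ β)
    (hw : w.val = 0) (hwC : w ∉ C) (hx1 : ∀ q ≠ w, 1 < x q) (hyn : y ∈ Icc 1 n)
    (hcard : β ≤ #(remaining n C x y)) (hJ : y ∉ (univ.erase w).image x → y ∈ J) :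
    ∃ s', Reach n β J C s s' ∧ Stage n β C x w (y + 1) s' := by
  by_cases hyx : y ∈ (univ.erase w).image x
  · obtain ⟨q, hq, rfl⟩ := mem_image.1 hyx
    have hqw : q ≠ w := ne_of_mem_erase hq
    by_cases hqC : q ∈ C
    · exact ⟨s, .refl s, h.skip hx (hx1 q hqw) hqw hqC rfl⟩
    · exact h.collide hx hβ hw hqw hqC hyn hcard
  · exact h.perform hβ hw hwC hyn hyx hcard (hJ hyx)

theorem exists_of_le {Y : ℕ} (h : Stage n β C x w 1 s) (hx : Function.Injective x) (hβ : m ≤ β)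
    (hw : w.val = 0) (hwC : w ∉ C) (hx1 : ∀ q ≠ w, 1 < x q)
    (hcard : ∀ y < Y, β ≤ #(remaining n C x y)) (hy : 1 ≤ y) (hyY : y ≤ Y) :
    ∃ s', Reach n β (performed x w Y) C s s' ∧ Stage n β C x w y s' := by
  induction y, hy using Nat.le_induction with
  | base => exact ⟨s, .refl s, h⟩
  | succ y hy ih =>
    obtain ⟨t, hreach, ht⟩ := ih (by omega)
    have hβy := hcard y hyY
    have hyn : y ≤ n := by
      have hpos : 0 < #(remaining n C x y) := (w.pos.trans_le hβ).trans_le hβy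
      obtain ⟨z, hz⟩ := card_pos.1 hpos
      obtain ⟨hyz, hzn⟩ := mem_Icc.1 (Finset.mem_sdiff.1 hz).1
      exact hyz.trans hzn
    obtain ⟨s', hreach', hs'⟩ := ht.exists_succ (J := performed x w Y) hx hβ hw hwC hx1
      (mem_Icc.2 ⟨hy, hyn⟩) hβy fun hyx => Finset.mem_sdiff.2 ⟨mem_Ico.2 ⟨hy, hyY⟩, hyx⟩
    exact ⟨s', hreach.trans hreach', hs'⟩

end Stage

variable {x : Fin m → ℕ} {w : Fin m} {y : ℕ} {s : State m}

theorem LocalInv.compNext_status_eq_finished {p : Fin m} {l : LocalState m}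
    (hl : LocalInv n β p l) (hdone : l.done = performed x w y) (hwC : w ∉ C)
    (htry : ∀ q ≠ w, x q ∈ l.try_) (hcard : #(remaining n C x y) < β) :
    (l.compNext β p).status = .finished := by
  have hlt : #(l.free \ l.try_) < β := by
    rw [hl.free_eq, hdone]
    exact (card_le_card (sdiff_subset_remaining hwC htry)).trans_lt hcard
  rw [LocalState.compNext, if_neg hlt.not_ge]

namespace Stage

theorem next_eq_self (h : Stage n β C x w y s) (hlt : ∀ q ≠ w, q ∉ C → x q < y) {q : Fin m}
    (hq : q ≠ w) : s.next q = x q := by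
  rw [h.next_eq hq, if_pos (or_iff_not_imp_right.2 (hlt q hq))]

theorem exists_halted (h : Stage n β C x w y s) (hβ : m ≤ β) (hw : w.val = 0) (hwC : w ∉ C)
    (hy : 1 < y) (hlt : ∀ q ≠ w, q ∉ C → x q < y) (hcard : #(remaining n C x y) < β) {u : State m}
    (hu : Inv n β u) (hrec : u.recorded = s.recorded) (hnext : u.next = s.next) {q : Fin m}
    (hloc : u.loc q = s.loc q) :
    ∃ l, Reach n β J C u (u.setLoc q l) ∧ (l.status = .finished ∨ l.status = .stopped) := by
  rcases eq_or_ne q w with rfl | hqw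
  · refine ⟨_, .single (.compNext q) ⟨hloc ▸ h.status_eq, rfl⟩, Or.inl ?_⟩
    rw [hloc]
    exact (h.inv.loc q).compNext_status_eq_finished
      (coe_injective (h.done_eq.trans h.recorded_eq)) hwC
      (fun j hj => h.subset_try hy ⟨j, hj, h.next_eq_self hlt hj⟩) hcard
  have hbystander := h.bystander q hqw
  rw [← hloc] at hbystander
  generalize s.next q = v at hbystander
  cases hbystander with
  | crashed _ hst =>
    exact ⟨u.loc q, by simpa only [State.setLoc_loc] using Reach.refl u, Or.inr hst⟩
  | waiting hqC hle => exact absurd (hlt q hqw hqC) hle.not_gt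
  | paused hqC _ hst hloop htry hnxt =>
    have htry (j : Fin m) (hj : j ≠ w) : x j ∈ u.finalTry q := by
      rcases eq_or_ne j q with rfl | hjq
      · exact Or.inl (by simp [htry])
      · refine Or.inr ⟨j, ⟨hjq, ?_⟩, by rw [hnext, h.next_eq_self hlt hj]⟩
        have hj0 : j.val ≠ w.val := Fin.val_ne_of_ne hj
        rw [LocalState.visited_of_status_eq hst, mem_Iio, Fin.lt_def, hloop]
        omega
    obtain ⟨l, hreach, hst, hltry, hdone⟩ :=
      hu.reach_of_mem_finalTry (J := J) (C := C) hst (hnxt ▸ htry q hqw)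
    have hl : LocalInv n β q l := by simpa using (hreach.inv hβ hu).loc q
    exact ⟨l.compNext β q, hreach.trans (.single (.compNext q) ⟨by simpa using hst, by simp⟩),
      Or.inl (hl.compNext_status_eq_finished
        (coe_injective (hdone.trans (hrec.trans h.recorded_eq))) hwC
        (fun j hj => by rw [← mem_coe, hltry]; exact htry j hj) hcard)⟩

theorem reach_halted (h : Stage n β C x w y s) (hβ : m ≤ β) (hw : w.val = 0) (hwC : w ∉ C)
    (hy : 1 < y) (hlt : ∀ q ≠ w, q ∉ C → x q < y) (hcard : #(remaining n C x y) < β) :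
    ∃ s', Reach n β J C s s' ∧
      ∀ q, (s'.loc q).status = .finished ∨ (s'.loc q).status = .stopped := by
  obtain ⟨s', hreach, -, hhalted, -⟩ := Reach.forall_mem (n := n) (β := β) (J := J) (C := C)
    (R := fun u => Inv n β u ∧ u.recorded = s.recorded ∧ u.next = s.next)
    (Good := fun _ l _ => l.status = .finished ∨ l.status = .stopped) univ ⟨h.inv, rfl, rfl⟩ (by
      rintro q - u ⟨hu, hrec, hnext⟩ hloc -
      obtain ⟨l, hreach, hl⟩ := h.exists_halted hβ hw hwC hy hlt hcard hu hrec hnext hloc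
      exact ⟨u.setLoc q l, hreach, ⟨hreach.inv hβ hu, hrec, hnext⟩, fun j hj => by simp [hj],
        by simpa using hl⟩)
  exact ⟨s', hreach, fun q => hhalted q (mem_univ q)⟩

end Stage

/-! ### Counting -/

theorem remaining_antitone : Antitone (remaining n C x) := fun _ _ h =>
  sdiff_subset_sdiff (Icc_subset_Icc_left h) subset_rfl

theorem card_remaining_le_succ (y : ℕ) :
    #(remaining n C x y) ≤ #(remaining n C x (y + 1)) + 1 := by
  refine (card_le_card fun z hz => ?_).trans (card_insert_le y _)
  simp only [remaining, mem_insert, Finset.mem_sdiff, mem_Icc] at hz ⊢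
  grind

theorem le_card_remaining (y : ℕ) : n + 1 ≤ #(remaining n C x y) + y + #C := by
  have hle := le_card_sdiff (C.image x) (Icc y n)
  have hC : #(C.image x) ≤ #C := card_image_le
  rw [Nat.card_Icc] at hle
  rw [remaining]
  omega

theorem card_performed_add_card_remaining_le (hx : Function.Injective x)
    (hxn : ∀ q, x q ∈ Icc 1 n) (hlt : ∀ q ≠ w, q ∉ C → x q < y)
    (hy1 : 1 ≤ y) (hyn : y ≤ n + 1) :
    #(performed x w y) + #(remaining n C x y) + (m - 1) ≤ n := by
  have hsub : performed x w y ∪ remaining n C x y ⊆ Icc 1 n \ (univ.erase w).image x := by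
    refine union_subset (sdiff_subset_sdiff (fun z hz => ?_) subset_rfl) fun z hz => ?_
    · rw [mem_Ico] at hz
      exact mem_Icc.2 (by omega)
    · obtain ⟨hz, hzC⟩ := Finset.mem_sdiff.1 hz
      obtain ⟨hyz, hzn⟩ := mem_Icc.1 hz
      refine Finset.mem_sdiff.2 ⟨mem_Icc.2 ⟨hy1.trans hyz, hzn⟩, fun hzX => ?_⟩
      obtain ⟨q, hq, rfl⟩ := mem_image.1 hzX
      exact (hlt q (ne_of_mem_erase hq) fun hqC => hzC (mem_image_of_mem x hqC)).not_ge hyz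
  have hdisj : Disjoint (performed x w y) (remaining n C x y) :=
    Disjoint.mono sdiff_subset sdiff_subset <| disjoint_left.2 fun z hz hz' =>
      (mem_Ico.1 hz).2.not_ge (mem_Icc.1 hz').1
  have hX : (univ.erase w).image x ⊆ Icc 1 n := image_subset_iff.2 fun q _ => hxn q
  have hcard := card_le_card hsub
  rw [card_union_of_disjoint hdisj, card_sdiff_of_subset hX, card_image_of_injective _ hx,
    card_erase_of_mem (mem_univ w), card_fin, Nat.card_Icc] at hcard
  have hmn := card_le_card hX
  rw [card_image_of_injective _ hx, card_erase_of_mem (mem_univ w), card_fin, Nat.card_Icc] at hmn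
  omega

/-- The first `y` from which on fewer than `β` jobs remain; then the worker terminates. -/
noncomputable def cutoff (n β : ℕ) (C : Finset (Fin m)) (x : Fin m → ℕ) : ℕ :=
  sInf {y | #(remaining n C x y) < β}

theorem card_remaining_succ_lt (hβ : 0 < β) : #(remaining n C x (n + 1)) < β := by
  simpa [remaining] using hβ

theorem cutoff_le (hβ : 0 < β) : cutoff n β C x ≤ n + 1 :=
  Nat.sInf_le (card_remaining_succ_lt hβ)

theorem card_remaining_cutoff_lt (hβ : 0 < β) : #(remaining n C x (cutoff n β C x)) < β :=
  Nat.sInf_mem (s := {y | #(remaining n C x y) < β}) ⟨n + 1, card_remaining_succ_lt hβ⟩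

theorem le_card_remaining_of_lt_cutoff (hy : y < cutoff n β C x) : β ≤ #(remaining n C x y) :=
  not_lt.1 (Nat.notMem_of_lt_sInf (s := {y | #(remaining n C x y) < β}) hy)

theorem lt_cutoff (hβ : 0 < β) (hy : y + #C + β ≤ n + 1) : y < cutoff n β C x := by
  by_contra! hle
  have hlt := (card_le_card (remaining_antitone hle)).trans_lt (card_remaining_cutoff_lt hβ)
  have hge := le_card_remaining (n := n) (C := C) (x := x) y
  omega

theorem le_card_remaining_cutoff_add_one (h : 0 < cutoff n β C x) :
    β ≤ #(remaining n C x (cutoff n β C x)) + 1 := by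
  have hcard := card_remaining_le_succ (n := n) (C := C) (x := x) (cutoff n β C x - 1)
  rw [Nat.sub_add_cancel h] at hcard
  exact (le_card_remaining_of_lt_cutoff (Nat.sub_lt h one_pos)).trans hcard

theorem chosenRank_add_le {f q : ℕ} (hβ : m ≤ β) (hn : β + m - 1 ≤ n)
    (hlt : m * (β - m + f) < (f + 1) * (n - m + 1)) (hq : q + f + 1 ≤ m) :
    chosenRank m n q + f + β ≤ n + 1 := by
  obtain ⟨d, rfl⟩ := Nat.exists_eq_add_of_le hβ
  obtain ⟨N, hN⟩ := Nat.exists_eq_add_of_le (show m ≤ n + 1 by omega)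
  rw [show m + d - m + f = d + f by omega, show n - m + 1 = N by omega] at hlt
  have hqN : q * N + m * (d + f) < N * m := calc
    q * N + m * (d + f) < q * N + (f + 1) * N := Nat.add_lt_add_left hlt _
    _ = N * (q + f + 1) := by ring
    _ ≤ N * m := Nat.mul_le_mul_left N hq
  have hfloor : ⌊(q : ℚ) * (N / m)⌋₊ + (d + f) < N := by
    rw [← mul_div_assoc, ← Nat.cast_mul, Nat.floor_div_eq_div,
      ← Nat.add_mul_div_left _ _ (show 0 < m by omega)]
    exact Nat.div_lt_of_lt_mul (mul_comm N m ▸ hqN)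
  have ht : (n : ℚ) - (m - 1) = N := by
    have hN' : (n : ℚ) + 1 = m + N := by exact_mod_cast hN
    linarith
  simp only [chosenRank, ht]
  split_ifs <;> omega

/-! ### The upper bound -/

theorem not_enabled_of_halted
    (hs : ∀ q, (s.loc q).status = .finished ∨ (s.loc q).status = .stopped) {a : Action m}
    (ha : (algorithm n m β).isLocal a) : ¬ (algorithm n m β).Enabled s a := by
  rintro ⟨t, ht⟩
  have hsource := status_mem_source ht
  have hactor := hs a.actor
  cases a with
  | crash p => exact ha p rfl
  | _ => rcases hactor with hst | hst <;> rw [hst] at hsource <;> simp [Action.source] at hsource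

theorem Reach.exists_fair (hm : 0 < m) (h : Reach n β J C (initState n m) s)
    (hs : ∀ q, (s.loc q).status = .finished ∨ (s.loc q).status = .stopped) :
    ∃ e ∈ fairExecs (algorithm n m β) #C, numDone n e ≤ #J := by
  have : Nonempty (Action m) := ⟨.crash ⟨0, hm⟩⟩
  obtain ⟨e, r, hlen, rfl, hallowed⟩ := Automaton.Reaches.exists_execution h rfl
  have hfair : e.Fair := by
    refine ⟨fun r' hr' a ha => ?_,
      fun htop => absurd (hlen.symm.trans htop) (ENat.natCast_ne_top r)⟩
    rw [ENat.natCast_inj.1 (hr'.symm.trans hlen)]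
    exact not_enabled_of_halted hs ha
  refine ⟨e, ⟨hfair, ?_⟩, ?_⟩
  · rw [← Set.ncard_coe_finset]
    exact Set.ncard_le_ncard fun p hp => hallowed _ hp
  · rw [numDone, ← Set.ncard_coe_finset]
    exact Set.ncard_le_ncard fun j hj => hj.2.elim fun p hp => hallowed _ hp

theorem exists_fair_numDone_le {f : ℕ} (hβ : m ≤ β) (hf : f < m) (hn : β + m - 1 ≤ n)
    (hlt : m * (β - m + f) < (f + 1) * (n - m + 1)) :
    ∃ e ∈ fairExecs (algorithm n m β) f, numDone n e ≤ n - (β + m - 2) := by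
  have hm : 0 < m := by omega
  have hβ₀ : 0 < β := hm.trans_le hβ
  set w : Fin m := ⟨0, hm⟩ with hw
  set C : Finset (Fin m) := Ioi ⟨m - 1 - f, by omega⟩ with hC
  set x : Fin m → ℕ := fun q => chosenRank m n q
  set Y := cutoff n β C x
  have hcardC : #C = f := by
    rw [hC, Fin.card_Ioi]
    exact Nat.sub_sub_self (by omega)
  have hwC : w ∉ C := by simp [hC, hw, Fin.lt_def]
  have hmono : StrictMono x := fun _ _ h => chosenRank_strictMono m n h
  have hxn (q : Fin m) : x q ∈ Icc 1 n :=
    mem_Icc.2 ⟨one_le_chosenRank m n q, chosenRank_le q.2 (by omega) (by omega)⟩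
  have hx1 (q : Fin m) (hq : q ≠ w) : 1 < x q :=
    (mem_Icc.1 (hxn w)).1.trans_lt (hmono (lt_of_le_of_ne (Nat.zero_le _) hq.symm))
  have hxY (q : Fin m) (_ : q ≠ w) (hqC : q ∉ C) : x q < Y := by
    have hqf : q.val ≤ m - 1 - f := by simpa [hC, Fin.lt_def] using hqC
    exact lt_cutoff hβ₀ (hcardC ▸ chosenRank_add_le hβ hn hlt (by omega))
  have hY1 : 1 < Y := lt_cutoff hβ₀ (by omega)
  obtain ⟨s₁, hreach₁, hs₁⟩ := exists_stage_one (J := performed x w Y) (C := C) hβ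
    (show β ≤ n by omega) w
  obtain ⟨s₂, hreach₂, hs₂⟩ := hs₁.exists_of_le hmono.injective hβ rfl hwC hx1
    (fun y hy => le_card_remaining_of_lt_cutoff hy) hY1.le le_rfl
  obtain ⟨s₃, hreach₃, hs₃⟩ :=
    hs₂.reach_halted hβ rfl hwC hY1 hxY (card_remaining_cutoff_lt hβ₀)
  obtain ⟨e, he, hle⟩ := ((hreach₁.trans hreach₂).trans hreach₃).exists_fair hm hs₃
  refine ⟨e, hcardC ▸ he, hle.trans ?_⟩
  have hremaining : β ≤ #(remaining n C x Y) + 1 :=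
    le_card_remaining_cutoff_add_one (zero_lt_one.trans hY1)
  have hcount := card_performed_add_card_remaining_le hmono.injective hxn hxY hY1.le (cutoff_le hβ₀)
  omega

theorem hasEffectiveness {f : ℕ} (hβ : m ≤ β) (hf : f < m) (hn : β + m - 1 ≤ n)
    (hlt : m * (β - m + f) < (f + 1) * (n - m + 1)) :
    HasEffectiveness (algorithm n m β) n f (n - (β + m - 2)) := by
  obtain ⟨e, he, hle⟩ := exists_fair_numDone_le hβ hf hn hlt
  refine ⟨⟨e, he, hle.antisymm ?_⟩, ?_⟩
  · have hge := le_numDone hβ hf he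
    omega
  · rintro _ ⟨e, he, rfl⟩
    have hge := le_numDone hβ hf he
    omega

end KK

theorem theorem2 (n m β f : ℕ) (hnm : m ≤ n) (hβ : m ≤ β) (hf : f < m) :
    (∀ e ∈ KK.fairExecs (KK.algorithm n m β) f,
      e.len ≠ ⊤ ∧ n ≤ KK.numDone n e + (β + m - 2)) ∧
    (β + m - 1 ≤ n → m * (β - m + f) < (f + 1) * (n - m + 1) →
      KK.HasEffectiveness (KK.algorithm n m β) n f (n - (β + m - 2))) ∧
    (β = m → 2 * m - 1 ≤ n →
      KK.HasEffectiveness (KK.algorithm n m β) n f (n - (2 * m - 2))) := by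
  refine ⟨fun e he => ⟨e.len_ne_top hβ, KK.le_numDone hβ hf he⟩,
    KK.hasEffectiveness hβ hf, ?_⟩
  rintro rfl hn
  rw [two_mul]
  refine KK.hasEffectiveness hβ hf (by omega) ?_
  rw [Nat.sub_self, zero_add]
  calc β * f < β * (f + 1) := Nat.mul_lt_mul_of_pos_left (Nat.lt_succ_self f) (by omega)
    _ = (f + 1) * β := Nat.mul_comm _ _
    _ ≤ (f + 1) * (n - β + 1) := Nat.mul_le_mul_left _ (by omega)
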